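/- Let $N\ge 1$. For a real-valued function $u$ on $\mathbb R^N$ write $|\nabla^N u|=\Big(\sum_{i_1,\dots,i_N=1}^N\big(\tfrac{\partial^N u}{\partial x_{i_1}\cdots\partial x_{i_N}}\big)^2\Big)^{1/2}$ (classical derivatives where $u$ is smooth, weak derivatives if $u\in W^{N,1}(\mathbb R^N)$), and let $\omega_{N-1}$ be the surface area of the unit sphere $S^{N-1}\subset\mathbb R^N$ (so $\omega_0=2$). There is a (necessarily unique) constant $\ell_N>0$ such that $$|\nabla^N\log|x||=\frac{\sqrt{\ell_N}}{|x|^N}\qquad\text{for all }x\in\mathbb R^N\setminus\{0\},$$ and the following hold. (i) The optimal (smallest) constant $K_N$ in the inequality $\|u\|_\infty\le K_N\int_{\mathbb R^N}|\nabla^N u|\,dx$ is the same for $u\in C_c^\infty(\mathbb R^N)$ as for $u\in W^{N,1}(\mathbb R^N)$, and is equal to $(\sqrt{\ell_N}\,\omega_{N-1})^{-1}$. That is, $$\|u\|_\infty\le\frac{1}{\sqrt{\ell_N}\,\omega_{N-1}}\int_{\mathbb R^N}|\nabla^N u|\,dx\qquad\text{for all }u\in W^{N,1}(\mathbb R^N),\tag{$*$}$$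 and $(\sqrt{\ell_N}\,\omega_{N-1})^{-1}$ cannot be replaced by a smaller constant, neither on $W^{N,1}(\mathbb R^N)$ nor on $C_c^\infty(\mathbb R^N)$. (ii) If $N\ge 2$, then equality in $(*)$ holds for no function $u\in W^{N,1}(\mathbb R^N)$ other than the zero function. -/

import Mathlib

open MeasureTheory
open scoped ContDiff ENNReal

noncomputable section

/-- Euclidean space `ℝ^N` with its Euclidean norm. -/
abbrev RN (N : ℕ) : Type := EuclideanSpace ℝ (Fin N)

/-- The classical iterated partial derivative `∂^m u / ∂x_{i 0} ⋯ ∂x_{i (m-1)}` at `x`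
(for functions which are `C^m` near `x`). -/
def partialDeriv {N m : ℕ} (i : Fin m → Fin N) (u : RN N → ℝ) (x : RN N) : ℝ :=
  iteratedFDeriv ℝ m u x (fun j => EuclideanSpace.single (i j) (1 : ℝ))

/-- The Euclidean norm `|∇^m u|(x)` of the tensor of all classical partial derivatives of
order `m`, the sum running over all `m`-tuples of indices. -/
def gradNorm {N : ℕ} (m : ℕ) (u : RN N → ℝ) (x : RN N) : ℝ :=
  Real.sqrt (∑ i : Fin m → Fin N, (partialDeriv i u x) ^ 2)

/-- `g` is a weak (distributional) partial derivative `∂^m u / ∂x_{i 0} ⋯ ∂x_{i (m-1)}` of `u`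
on `ℝ^N`. -/
structure HasWeakPartial {N m : ℕ} (i : Fin m → Fin N) (u g : RN N → ℝ) : Prop where
  locallyIntegrable_fun : LocallyIntegrable u volume
  locallyIntegrable_deriv : LocallyIntegrable g volume
  integral_eq : ∀ φ : RN N → ℝ, ContDiff ℝ ∞ φ → HasCompactSupport φ →
    ∫ x, u x * partialDeriv i φ x = (-1) ^ m * ∫ x, g x * φ x

/-- `u ∈ W^{m,1}(ℝ^N)`: `u` is integrable, and all its weak partial derivatives of order at most
`m` exist and are integrable. -/
def MemW {N : ℕ} (m : ℕ) (u : RN N → ℝ) : Prop :=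
  Integrable u volume ∧
    ∀ k : ℕ, k ≤ m → ∀ i : Fin k → Fin N,
      ∃ g : RN N → ℝ, HasWeakPartial i u g ∧ Integrable g volume

open Classical in
/-- The weak partial derivative of `u` (unique up to equality almost everywhere); it is `0` when
there is none. -/
def weakPartial {N m : ℕ} (i : Fin m → Fin N) (u : RN N → ℝ) : RN N → ℝ :=
  if h : ∃ g : RN N → ℝ, HasWeakPartial i u g then h.choose else 0

/-- The Euclidean norm `|∇^m u|(x)` of the tensor of all weak partial derivatives of order `m`. -/
def weakGradNorm {N : ℕ} (m : ℕ) (u : RN N → ℝ) (x : RN N) : ℝ :=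
  Real.sqrt (∑ i : Fin m → Fin N, (weakPartial i u x) ^ 2)

/-- The surface area of the unit sphere of `ℝ^N`, usually denoted `ω_{N-1}`. -/
def sphereArea (N : ℕ) : ℝ :=
  (volume : Measure (RN N)).toSphere.real Set.univ

/-- `C` is admissible in `‖u‖_∞ ≤ C ∫ |∇^N u|` for all `u ∈ C_c^∞(ℝ^N)`. -/
def SmoothAdmissible (N : ℕ) (C : ℝ) : Prop :=
  ∀ u : RN N → ℝ, ContDiff ℝ ∞ u → HasCompactSupport u →
    eLpNorm u ∞ volume ≤ ENNReal.ofReal (C * ∫ x, gradNorm N u x)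

/-- `C` is admissible in `‖u‖_∞ ≤ C ∫ |∇^N u|` for all `u ∈ W^{N,1}(ℝ^N)`. -/
def SobolevAdmissible (N : ℕ) (C : ℝ) : Prop :=
  ∀ u : RN N → ℝ, MemW N u →
    eLpNorm u ∞ volume ≤ ENNReal.ofReal (C * ∫ x, weakGradNorm N u x)

end

/-! Put K(x) = |x|^N ∇^N log|x| (`kernel`). This field is homogeneous of degree 0 and, by rotation
invariance, of constant norm s off the origin; s is √ℓ_N. Its N-fold divergence off the origin is
rotation invariant of degree -N, hence κ|x|^(-N). Since K is bounded, κ = 0: otherwise integration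
by parts against dilated bumps would produce a logarithmically growing quantity. The divergence thus
lives at the origin, where homogeneity leaves only a multiple of the Dirac mass: ∫⟨∇^N u, K⟩ = c
u(0) for test functions (`exists_integral_inner_kernel`).

Smooth logarithmic cutoffs, equal to 1 near 0 and to 1 - log|x|/log M for 1 ≤ |x| ≤ M/2, give c =
-s²ω (`kernel_constant_eq`). The inequality is then Cauchy–Schwarz, and the same cutoffs show it is
sharp as M → ∞, their N-th gradient being parallel to K up to a small error (`SmoothAdmissible.le`).
For u in W^{N,1}, Fubini and testing against convolutions of K show that x ↦ ∫⟨∇^N u(y), K(y-x)⟩dy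
equals c u almost everywhere (`potential_ae_eq`).

In the equality case this potential is continuous and, because ∇^N u has mean zero, vanishes at
infinity; so its modulus has a maximum, at x₀ say. Equality in Cauchy–Schwarz there forces ∇^N u = h
K(·-x₀) with h integrable. Symmetry of weak derivatives, contracted repeatedly with x by Euler's
identity, reduces to a condition on the Hessian of log and then, for N ≥ 2, to ∫ h x·∇F = 0 for F
supported off 0. The measure h dx is therefore dilation invariant, which an integrable h allows only
if h = 0 (`ae_eq_zero_of_weakPartial_eq_mul_kernel`). -/

/-- The gradient tensor, as a vector with one coordinate for each tuple of indices. -/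
noncomputable def gradTensor {N : ℕ} (m : ℕ) (u : RN N → ℝ) (x : RN N) :
    EuclideanSpace ℝ (Fin m → Fin N) :=
  WithLp.toLp 2 (fun i => partialDeriv i u x)

@[simp] lemma gradTensor_apply {N m : ℕ} (u : RN N → ℝ) (x : RN N) (i : Fin m → Fin N) :
    gradTensor m u x i = partialDeriv i u x := rfl

lemma gradNorm_eq_norm {N m : ℕ} (u : RN N → ℝ) (x : RN N) :
    gradNorm m u x = ‖gradTensor m u x‖ := by
  simp [gradNorm, EuclideanSpace.norm_eq]

/-! ### Calculus of iterated partial derivatives. -/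

lemma iteratedFDeriv_comp_equiv {E F : Type*} [NormedAddCommGroup E] [NormedSpace ℝ E]
    [NormedAddCommGroup F] [NormedSpace ℝ F] (g : E ≃L[ℝ] E) (f : E → F) (x : E) (m : ℕ) :
    iteratedFDeriv ℝ m (fun y => f (g y)) x =
      (iteratedFDeriv ℝ m f (g x)).compContinuousLinearMap fun _ => (g : E →L[ℝ] E) := by
  have := g.iteratedFDerivWithin_comp_right f (s := Set.univ) uniqueDiffOn_univ (x := x)
    (Set.mem_univ _) m
  simpa [iteratedFDerivWithin_univ, Function.comp_def] using this

section partialDeriv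

variable {N m : ℕ}

lemma partialDeriv_congr {u v : RN N → ℝ} {x : RN N} (h : u =ᶠ[nhds x] v) (i : Fin m → Fin N) :
    partialDeriv i u x = partialDeriv i v x := by
  simp only [partialDeriv, (h.iteratedFDeriv ℝ m).eq_of_nhds]

lemma partialDeriv_comp_smul {a : ℝ} (ha : a ≠ 0) (u : RN N → ℝ) (x : RN N) (i : Fin m → Fin N) :
    partialDeriv i (fun y => u (a • y)) x = a ^ m * partialDeriv i u (a • x) := by
  have := iteratedFDeriv_comp_equiv (ContinuousLinearEquiv.smulLeft (Units.mk0 a ha)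
    : RN N ≃L[ℝ] RN N) u x m
  simp only [ContinuousLinearEquiv.smulLeft_apply_apply, Units.smul_mk0] at this
  simp only [partialDeriv, this, ContinuousMultilinearMap.compContinuousLinearMap_apply,
    ContinuousLinearEquiv.coe_coe, ContinuousLinearEquiv.smulLeft_apply_apply, Units.smul_mk0]
  rw [ContinuousMultilinearMap.map_smul_univ]
  simp

lemma partialDeriv_comp_add (u : RN N → ℝ) (a x : RN N) (i : Fin m → Fin N) :
    partialDeriv i (fun y => u (y + a)) x = partialDeriv i u (x + a) := by
  simp only [partialDeriv, iteratedFDeriv_comp_add_right]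

lemma partialDeriv_comp_sub_left (u : RN N → ℝ) (a x : RN N) (i : Fin m → Fin N) :
    partialDeriv i (fun y => u (a - y)) x = (-1) ^ m * partialDeriv i u (a - x) := by
  have h := partialDeriv_comp_smul (a := -1) (by norm_num) (fun y => u (y + a)) x i
  rw [partialDeriv_comp_add] at h
  simpa [neg_add_eq_sub] using h

lemma partialDeriv_cons {u : RN N → ℝ} {x : RN N} (hu : ContDiffAt ℝ ∞ u x) (a : Fin N)
    (i : Fin m → Fin N) : partialDeriv (Fin.cons a i : Fin (m + 1) → Fin N) u x =
      fderiv ℝ (partialDeriv i u) x (EuclideanSpace.single a 1) := by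
  have hd : DifferentiableAt ℝ (iteratedFDeriv ℝ m u) x :=
    hu.differentiableAt_iteratedFDeriv (by exact_mod_cast WithTop.coe_lt_top m)
  have h : fderiv ℝ (partialDeriv i u) x =
      (ContinuousMultilinearMap.apply ℝ (fun _ : Fin m => RN N) ℝ
        (fun j => EuclideanSpace.single (i j) (1 : ℝ))).comp (fderiv ℝ (iteratedFDeriv ℝ m u) x) :=
    ((ContinuousMultilinearMap.apply ℝ (fun _ : Fin m => RN N) ℝ
        (fun j => EuclideanSpace.single (i j) (1 : ℝ))).hasFDerivAt.comp x hd.hasFDerivAt).fderiv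
  rw [h, partialDeriv, iteratedFDeriv_succ_apply_left]
  rfl

lemma ContDiffAt.partialDeriv {u : RN N → ℝ} {x : RN N} (hu : ContDiffAt ℝ ∞ u x)
    (i : Fin m → Fin N) : ContDiffAt ℝ ∞ (partialDeriv i u) x := by
  have h : ContDiffAt ℝ ∞ (iteratedFDeriv ℝ m u) x :=
    hu.iteratedFDeriv_right (by norm_cast)
  exact h.continuousLinearMap_comp (ContinuousMultilinearMap.apply ℝ (fun _ : Fin m => RN N) ℝ
        (fun j => EuclideanSpace.single (i j) (1 : ℝ)))

lemma ContDiff.partialDeriv {u : RN N → ℝ} (hu : ContDiff ℝ ∞ u)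
    (i : Fin m → Fin N) : ContDiff ℝ ∞ (partialDeriv i u) :=
  contDiff_iff_contDiffAt.2 fun _ => hu.contDiffAt.partialDeriv i

lemma HasCompactSupport.partialDeriv {u : RN N → ℝ} (hu : HasCompactSupport u)
    (i : Fin m → Fin N) : HasCompactSupport (partialDeriv i u) :=
  (hu.iteratedFDeriv (𝕜 := ℝ) m).comp_left
    (g := fun A : ContinuousMultilinearMap ℝ (fun _ : Fin m => RN N) ℝ =>
      A (fun j => EuclideanSpace.single (i j) (1 : ℝ))) rfl

lemma partialDeriv_const_mul {u : RN N → ℝ} {x : RN N} (hu : ContDiffAt ℝ ∞ u x) (a : ℝ)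
    (i : Fin m → Fin N) : partialDeriv i (fun y => a * u y) x = a * partialDeriv i u x := by
  have := iteratedFDeriv_const_smul_apply' (a := a) (i := m)
    (hu.of_le (by exact_mod_cast le_top))
  simp only [smul_eq_mul] at this
  simp [_root_.partialDeriv, this]

lemma partialDeriv_add {u v : RN N → ℝ} {x : RN N} (hu : ContDiffAt ℝ ∞ u x)
    (hv : ContDiffAt ℝ ∞ v x) (i : Fin m → Fin N) :
    partialDeriv i (fun y => u y + v y) x = partialDeriv i u x + partialDeriv i v x := by
  have h := iteratedFDeriv_add_apply (i := m) (hu.of_le (by exact_mod_cast le_top))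
    (hv.of_le (by exact_mod_cast le_top))
  simp only [_root_.partialDeriv]
  change iteratedFDeriv ℝ m (u + v) x _ = _
  rw [h]; rfl

lemma partialDeriv_const (hm : m ≠ 0) (a : ℝ) (x : RN N) (i : Fin m → Fin N) :
    partialDeriv i (fun _ => a) x = 0 := by
  simp [partialDeriv, iteratedFDeriv_const_of_ne hm]

/-- Symmetry of second derivatives, applied once per index, carries the innermost derivative to the
outside. Integration by parts needs this, since it peels off outermost derivatives. -/
lemma partialDeriv_fderiv_comm {u : RN N → ℝ} (hu : ContDiff ℝ ∞ u) (a : Fin N)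
    (i : Fin m → Fin N) (x : RN N) :
    partialDeriv i (fun y => fderiv ℝ u y (EuclideanSpace.single a 1)) x =
      fderiv ℝ (partialDeriv i u) x (EuclideanSpace.single a 1) := by
  have hdu : ContDiff ℝ ∞ (fun y => fderiv ℝ u y (EuclideanSpace.single a 1)) :=
    (hu.fderiv_right (by norm_cast)).clm_apply contDiff_const
  induction m generalizing x with
  | zero =>
    have : partialDeriv i u = u := by ext y; simp [partialDeriv]
    rw [this]; simp [partialDeriv]
  | succ m ih =>
    rw [← Fin.cons_self_tail i, partialDeriv_cons hdu.contDiffAt]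
    have h1 : partialDeriv (Fin.tail i) (fun y => fderiv ℝ u y (EuclideanSpace.single a 1)) =
      fun x => fderiv ℝ (partialDeriv (Fin.tail i) u) x (EuclideanSpace.single a 1) :=
      funext fun x => ih (Fin.tail i) x
    have h2 : partialDeriv (Fin.cons (i 0) (Fin.tail i) : Fin (m + 1) → Fin N) u =
      fun x => fderiv ℝ (partialDeriv (Fin.tail i) u) x (EuclideanSpace.single (i 0) 1) :=
      funext fun x => partialDeriv_cons hu.contDiffAt (i 0) (Fin.tail i)
    rw [h1, h2]
    have hw : ContDiff ℝ ∞ (partialDeriv (Fin.tail i) u) := hu.partialDeriv _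
    set w := partialDeriv (Fin.tail i) u
    have hd : DifferentiableAt ℝ (fderiv ℝ w) x :=
      (hw.fderiv_right (m := 1) (by norm_cast)).differentiable (by norm_num) x
    rw [fderiv_clm_apply hd (by fun_prop), fderiv_clm_apply hd (by fun_prop)]
    have := (hw.contDiffAt (x := x)).isSymmSndFDerivAt (by simp; norm_cast)
    simpa using this.eq _ _

end partialDeriv

lemma fderiv_comp_fderiv_apply {E F : Type*} [NormedAddCommGroup E] [NormedSpace ℝ E]
    [NormedAddCommGroup F] [NormedSpace ℝ F] {w : E → F} {x : E}
    (hd : DifferentiableAt ℝ (fderiv ℝ w) x) (A : F →L[ℝ] ℝ) (a b : E) :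
    fderiv ℝ (fun y => A (fderiv ℝ w y b)) x a = A (fderiv ℝ (fderiv ℝ w) x a b) := by
  have h1 : HasFDerivAt (fun y => fderiv ℝ w y b) ((fderiv ℝ (fderiv ℝ w) x).flip b) x := by
    simpa using hd.hasFDerivAt.clm_apply (hasFDerivAt_const b x)
  have h2 := (A.hasFDerivAt.comp x h1).fderiv
  simp only [Function.comp_def] at h2
  rw [h2]; rfl

/-- Swapping the first two indices of an iterated partial derivative. -/
lemma partialDeriv_swap {N m : ℕ} {u : RN N → ℝ} {x : RN N} (hu : ContDiffAt ℝ ∞ u x)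
    (a b : Fin N) (i : Fin m → Fin N) :
    partialDeriv (Fin.cons a (Fin.cons b i : Fin (m + 1) → Fin N) : Fin (m + 2) → Fin N) u x =
    partialDeriv (Fin.cons b (Fin.cons a i : Fin (m + 1) → Fin N) : Fin (m + 2) → Fin N) u x := by
  have hw : ContDiffAt ℝ ∞ (iteratedFDeriv ℝ m u) x := hu.iteratedFDeriv_right (by norm_cast)
  have hs := hw.isSymmSndFDerivAt (by simp; norm_cast)
  have key : ∀ a b : Fin N, partialDeriv (Fin.cons a (Fin.cons b i : Fin (m + 1) → Fin N) :
      Fin (m + 2) → Fin N) u x = fderiv ℝ (fderiv ℝ (iteratedFDeriv ℝ m u)) x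
        (EuclideanSpace.single a 1) (EuclideanSpace.single b 1)
        (fun j => EuclideanSpace.single (i j) (1 : ℝ)) := by
    intro a b
    have hd : DifferentiableAt ℝ (fderiv ℝ (iteratedFDeriv ℝ m u)) x :=
      (hw.fderiv_right (m := 1) (by norm_cast)).differentiableAt (by norm_num)
    rw [partialDeriv_cons hu]
    exact fderiv_comp_fderiv_apply hd (ContinuousMultilinearMap.apply ℝ (fun _ : Fin m => RN N) ℝ
        (fun j => EuclideanSpace.single (i j) (1 : ℝ))) _ _
  rw [key, key, hs.eq]

/-! ### Integration by parts and weak derivatives. -/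

section

variable {N m : ℕ}

/-- Compact support of one factor suffices, so `Z` may later be a component of the truncated kernel,
which does not decay. -/
lemma integral_partialDeriv_mul {u Z : RN N → ℝ} (hu : ContDiff ℝ ∞ u) (hs : HasCompactSupport u)
    (hZ : ContDiff ℝ ∞ Z) (i : Fin m → Fin N) :
    ∫ x, partialDeriv i u x * Z x = (-1) ^ m * ∫ x, u x * partialDeriv i Z x := by
  induction m generalizing Z with
  | zero => simp [partialDeriv]
  | succ m ih =>
    rw [← Fin.cons_self_tail i]
    set a := i 0
    set j := Fin.tail i
    have hdZ : ContDiff ℝ ∞ (fun y => fderiv ℝ Z y (EuclideanSpace.single a 1)) :=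
      (hZ.fderiv_right (by norm_cast)).clm_apply contDiff_const
    have hw : ContDiff ℝ ∞ (partialDeriv j u) := hu.partialDeriv j
    have hws : HasCompactSupport (partialDeriv j u) := hs.partialDeriv j
    have hdw : ContDiff ℝ ∞ (fun y => fderiv ℝ (partialDeriv j u) y (EuclideanSpace.single a 1)) :=
      (hw.fderiv_right (by norm_cast)).clm_apply contDiff_const
    have hdws : HasCompactSupport
        (fun y => fderiv ℝ (partialDeriv j u) y (EuclideanSpace.single a 1)) :=
      (hws.fderiv (𝕜 := ℝ)).comp_left (g := fun A : RN N →L[ℝ] ℝ => A (EuclideanSpace.single a 1)) rfl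
    have key := integral_mul_fderiv_eq_neg_fderiv_mul_of_integrable (μ := (volume : Measure (RN N)))
      (f := Z) (g := partialDeriv j u) (v := EuclideanSpace.single a 1)
      ((hdZ.continuous.mul hw.continuous).integrable_of_hasCompactSupport hws.mul_left)
      ((hZ.continuous.mul hdw.continuous).integrable_of_hasCompactSupport hdws.mul_left)
      ((hZ.continuous.mul hw.continuous).integrable_of_hasCompactSupport hws.mul_left)
      (fun x _ => hZ.differentiable (by norm_num) x) (fun x _ => hw.differentiable (by norm_num) x)
    have h1 : ∀ x, partialDeriv (Fin.cons a j : Fin (m + 1) → Fin N) u x * Z x =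
        Z x * fderiv ℝ (partialDeriv j u) x (EuclideanSpace.single a 1) := fun x => by
      rw [partialDeriv_cons hu.contDiffAt, mul_comm]
    have h2 : ∀ x, partialDeriv (Fin.cons a j : Fin (m + 1) → Fin N) Z x =
        partialDeriv j (fun y => fderiv ℝ Z y (EuclideanSpace.single a 1)) x := fun x => by
      rw [partialDeriv_cons hZ.contDiffAt, partialDeriv_fderiv_comm hZ]
    simp_rw [h1, h2, key]
    simp_rw [mul_comm (fderiv ℝ Z _ _)]
    rw [ih hdZ]
    ring

lemma HasWeakPartial.of_contDiff {u : RN N → ℝ} (hu : ContDiff ℝ ∞ u) (hs : HasCompactSupport u)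
    (i : Fin m → Fin N) : HasWeakPartial i u (partialDeriv i u) where
  locallyIntegrable_fun := hu.continuous.locallyIntegrable
  locallyIntegrable_deriv := (hu.partialDeriv i).continuous.locallyIntegrable
  integral_eq φ hφ _ := by
    rw [integral_partialDeriv_mul hu hs hφ, ← mul_assoc, ← mul_pow]
    simp

lemma MemW.of_contDiff {u : RN N → ℝ} (hu : ContDiff ℝ ∞ u) (hs : HasCompactSupport u) :
    MemW m u :=
  ⟨hu.continuous.integrable_of_hasCompactSupport hs, fun _ _ i =>
    ⟨_, .of_contDiff hu hs i,
      (hu.partialDeriv i).continuous.integrable_of_hasCompactSupport (hs.partialDeriv i)⟩⟩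

lemma HasWeakPartial.ae_eq {u g g' : RN N → ℝ} {i : Fin m → Fin N} (h : HasWeakPartial i u g)
    (h' : HasWeakPartial i u g') : g =ᵐ[volume] g' := by
  refine ae_eq_of_integral_contDiff_smul_eq h.locallyIntegrable_deriv h'.locallyIntegrable_deriv
    fun φ hφ hs => ?_
  have := (h.integral_eq φ hφ hs).symm.trans (h'.integral_eq φ hφ hs)
  have h1 := mul_left_cancel₀ (pow_ne_zero m (by norm_num : (-1 : ℝ) ≠ 0)) this
  simpa only [smul_eq_mul, mul_comm] using h1

lemma HasWeakPartial.weakPartial {u g : RN N → ℝ} {i : Fin m → Fin N} (h : HasWeakPartial i u g) :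
    HasWeakPartial i u (weakPartial i u) := by
  have hex : ∃ g, HasWeakPartial i u g := ⟨g, h⟩
  rw [_root_.weakPartial, dif_pos hex]
  exact hex.choose_spec

lemma MemW.hasWeakPartial {u : RN N → ℝ} (hu : MemW m u) (i : Fin m → Fin N) :
    HasWeakPartial i u (weakPartial i u) ∧ Integrable (weakPartial i u) volume := by
  obtain ⟨g, hg, hi⟩ := hu.2 m le_rfl i
  exact ⟨hg.weakPartial, hi.congr (hg.ae_eq hg.weakPartial)⟩

lemma weakGradNorm_ae_eq_gradNorm {u : RN N → ℝ} (hu : ContDiff ℝ ∞ u)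
    (hs : HasCompactSupport u) : weakGradNorm m u =ᵐ[volume] gradNorm m u := by
  have : ∀ᵐ x, ∀ i : Fin m → Fin N, weakPartial i u x = partialDeriv i u x :=
    ae_all_iff.2 fun i =>
      (HasWeakPartial.of_contDiff hu hs i).weakPartial.ae_eq (.of_contDiff hu hs i)
  filter_upwards [this] with x hx
  simp [weakGradNorm, gradNorm, hx]

lemma abs_partialDeriv_le (i : Fin m → Fin N) (f : RN N → ℝ) (x : RN N) :
    |partialDeriv i f x| ≤ ‖iteratedFDeriv ℝ m f x‖ := by
  have := (iteratedFDeriv ℝ m f x).le_opNorm (fun j => EuclideanSpace.single (i j) (1 : ℝ))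
  simpa [partialDeriv] using this

/-- A smooth cutoff, equal to one on the ball of radius `1/2` and vanishing off the unit ball. -/
noncomputable def cutoff (N : ℕ) : ContDiffBump (0 : RN N) := ⟨1 / 2, 1, by norm_num, by norm_num⟩

/-- The chain rule produces a factor a^k ≤ 1, so one bound serves all dilations; it dominates the
limit in which the cutoffs exhaust the space. -/
lemma exists_bound_iteratedFDeriv_cutoff (N k : ℕ) :
    ∃ C, ∀ a : ℝ, 0 ≤ a → a ≤ 1 → ∀ x,
      ‖iteratedFDeriv ℝ k (fun y => cutoff N (a • y)) x‖ ≤ C := by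
  have hc : ContDiff ℝ ∞ (cutoff N) := (cutoff N).contDiff
  obtain ⟨C, hC⟩ := ((hc.of_le (by exact_mod_cast le_top)).continuous_iteratedFDeriv'
    (m := k)).bounded_above_of_compact_support ((cutoff N).hasCompactSupport.iteratedFDeriv k)
  refine ⟨C, fun a ha ha1 x => ?_⟩
  rw [iteratedFDeriv_comp_const_smul a (hc.of_le (by exact_mod_cast le_top)), norm_smul, norm_pow,
    Real.norm_of_nonneg ha]
  exact (mul_le_of_le_one_left (norm_nonneg _) (pow_le_one₀ ha ha1)).trans (hC _)

/-- Integrable functions with integrable weak derivatives may be tested against smooth functions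
all of whose derivatives are bounded. -/
lemma HasWeakPartial.integral_eq_of_bounded {u g : RN N → ℝ} {i : Fin m → Fin N}
    (h : HasWeakPartial i u g) (hu : Integrable u volume) (hg : Integrable g volume)
    {Ψ : RN N → ℝ} (hΨ : ContDiff ℝ ∞ Ψ)
    (hb : ∀ k : ℕ, ∃ C, ∀ x, ‖iteratedFDeriv ℝ k Ψ x‖ ≤ C) :
    ∫ x, u x * partialDeriv i Ψ x = (-1) ^ m * ∫ x, g x * Ψ x := by
  choose B hB using hb
  choose C hC using exists_bound_iteratedFDeriv_cutoff N
  let a : ℕ → ℝ := fun n => 1 / ((n : ℝ) + 1)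
  have ha0 : ∀ n, 0 < a n := fun n => by positivity
  have ha1 : ∀ n, a n ≤ 1 := fun n => by
    rw [div_le_one (by positivity)]; linarith [(Nat.cast_nonneg n : (0 : ℝ) ≤ n)]
  have hlim : Filter.Tendsto a Filter.atTop (nhds 0) := tendsto_one_div_add_atTop_nhds_zero_nat
  let η : ℕ → RN N → ℝ := fun n x => cutoff N (a n • x)
  have hη : ∀ n, ContDiff ℝ ∞ (η n) := fun n =>
    (cutoff N).contDiff.comp (contDiff_const_smul (a n))
  have hηs : ∀ n, HasCompactSupport (η n) := fun n =>
    (cutoff N).hasCompactSupport.comp_smul (ha0 n).ne'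
  -- Near a fixed point the cutoffs are eventually identically one, so the derivatives of `Ψ * η n`
  -- become equal to those of `Ψ` and pointwise convergence is immediate.
  have hη1 : ∀ x, ∀ᶠ n in Filter.atTop, η n =ᶠ[nhds x] 1 := by
    intro x
    have : Filter.Tendsto (fun n => a n • x) Filter.atTop (nhds 0) := by
      simpa using hlim.smul_const x
    filter_upwards [this.eventually (Metric.ball_mem_nhds 0 (cutoff N).rIn_pos)] with n hn
    have hev : ∀ᶠ y in nhds x, a n • y ∈ Metric.ball (0 : RN N) (cutoff N).rIn :=
      (continuous_const_smul (a n)).continuousAt.eventually (Metric.isOpen_ball.mem_nhds hn)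
    filter_upwards [hev] with y hy
    exact (cutoff N).one_of_mem_closedBall (Metric.ball_subset_closedBall hy)
  have hη01 : ∀ n x, |η n x| ≤ 1 := fun n x => by
    rw [abs_of_nonneg (cutoff N).nonneg]; exact (cutoff N).le_one
  have e : ∀ n, ∫ x, u x * partialDeriv i (fun y => Ψ y * η n y) x =
      (-1) ^ m * ∫ x, g x * (Ψ x * η n x) := fun n =>
    h.integral_eq _ (hΨ.mul (hη n)) (hηs n).mul_left
  have l1 : Filter.Tendsto (fun n => ∫ x, u x * partialDeriv i (fun y => Ψ y * η n y) x)
      Filter.atTop (nhds (∫ x, u x * partialDeriv i Ψ x)) := by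
    refine tendsto_integral_of_dominated_convergence
      -- The dominating constant is the Leibniz bound for the derivatives of the product.
      (fun x => ‖u x‖ * ∑ k ∈ Finset.range (m + 1), (m.choose k : ℝ) * B k * C (m - k)) ?_ ?_ ?_ ?_
    · exact fun n => hu.aestronglyMeasurable.mul
        ((hΨ.mul (hη n)).partialDeriv i).continuous.aestronglyMeasurable
    · exact hu.norm.mul_const _
    · intro n
      refine .of_forall fun x => ?_
      rw [norm_mul]
      refine mul_le_mul_of_nonneg_left ?_ (norm_nonneg _)
      refine (abs_partialDeriv_le _ _ _).trans ((norm_iteratedFDeriv_mul_le (N := ∞) hΨ (hη n) x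
        (by exact_mod_cast le_top)).trans ?_)
      refine Finset.sum_le_sum fun k _ => ?_
      have := (norm_nonneg _).trans (hB k x)
      gcongr
      · exact hB k x
      · exact hC _ _ (ha0 n).le (ha1 n) x
    · refine .of_forall fun x => tendsto_const_nhds.congr' ?_
      filter_upwards [hη1 x] with n hn
      have : (fun y => Ψ y * η n y) =ᶠ[nhds x] Ψ := by
        filter_upwards [hn] with y hy
        simp [hy]
      rw [partialDeriv_congr this]
  have l2 : Filter.Tendsto (fun n => ∫ x, g x * (Ψ x * η n x))
      Filter.atTop (nhds (∫ x, g x * Ψ x)) := by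
    refine tendsto_integral_of_dominated_convergence (fun x => ‖g x‖ * B 0) ?_ ?_ ?_ ?_
    · exact fun n => hg.aestronglyMeasurable.mul (hΨ.mul (hη n)).continuous.aestronglyMeasurable
    · exact hg.norm.mul_const _
    · intro n
      refine .of_forall fun x => ?_
      rw [norm_mul]
      refine mul_le_mul_of_nonneg_left ?_ (norm_nonneg _)
      rw [norm_mul]
      have h0 := hB 0 x
      rw [norm_iteratedFDeriv_zero] at h0
      calc ‖Ψ x‖ * ‖η n x‖ ≤ ‖Ψ x‖ * 1 := by gcongr; exact hη01 n x
        _ ≤ B 0 := by simpa using h0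
    · refine .of_forall fun x => tendsto_const_nhds.congr' ?_
      filter_upwards [hη1 x] with n hn
      simp [hn.eq_of_nhds]
  simp_rw [e] at l1
  exact tendsto_nhds_unique l1 (l2.const_mul _)

end

/-! ### Symmetry and homogeneity of the derivatives of the logarithm. -/

/-- The logarithm of the Euclidean norm. -/
noncomputable def logNorm (N : ℕ) (y : RN N) : ℝ := Real.log ‖y‖

section

variable {N m : ℕ}

lemma contDiffAt_logNorm {x : RN N} (hx : x ≠ 0) : ContDiffAt ℝ ∞ (logNorm N) x :=
  (contDiffAt_norm ℝ hx).log (norm_ne_zero_iff.2 hx)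

lemma sum_coord_smul_single (x : RN N) : ∑ p, x p • EuclideanSpace.single p (1 : ℝ) = x := by
  have := (EuclideanSpace.basisFun (Fin N) ℝ).sum_repr x
  simpa using this

lemma sum_coord_mul_clm (A : RN N →L[ℝ] ℝ) (x : RN N) :
    ∑ p, x p * A (EuclideanSpace.single p 1) = A x := by
  conv_rhs => rw [← sum_coord_smul_single x]
  simp

lemma iteratedFDeriv_clm_apply_left {E F : Type*} [NormedAddCommGroup E] [NormedSpace ℝ E]
    [NormedAddCommGroup F] [NormedSpace ℝ F] {w : E → F} {x : E} (hw : ContDiffAt ℝ ∞ w x)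
    (A : F →L[ℝ] ℝ) (m : ℕ) (v : Fin m → E) :
    iteratedFDeriv ℝ m (fun y => A (w y)) x v = A (iteratedFDeriv ℝ m w x v) := by
  have := A.iteratedFDeriv_comp_left hw (i := m) (by exact_mod_cast le_top)
  simp only [Function.comp_def] at this
  rw [this]; rfl

/-- The full contraction of a bilinear expression in two tensors is invariant under isometries. -/
lemma sum_contraction_isometry (R : RN N ≃ₗᵢ[ℝ] RN N)
    (F : ContinuousMultilinearMap ℝ (fun _ : Fin m => RN N)
      (ContinuousMultilinearMap ℝ (fun _ : Fin m => RN N) ℝ)) :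
    ∑ i : Fin m → Fin N, F (fun j => R (EuclideanSpace.single (i j) 1))
        (fun j => R (EuclideanSpace.single (i j) 1)) =
      ∑ i : Fin m → Fin N, F (fun j => EuclideanSpace.single (i j) 1)
        (fun j => EuclideanSpace.single (i j) 1) := by
  let e : Fin N → RN N := fun i => EuclideanSpace.single i 1
  let r : Fin N → Fin N → ℝ := fun a k => R (e a) k
  have hr : ∀ a, R (e a) = ∑ k, r a k • e k := fun a => (sum_coord_smul_single _).symm
  -- Parseval's identity for the orthonormal basis R e_a.
  have horth : ∀ k l, ∑ a, r a k * r a l = if k = l then 1 else 0 := by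
    intro k l
    let b := (EuclideanSpace.basisFun (Fin N) ℝ).map R
    have := b.sum_inner_mul_inner (e k) (e l)
    simpa [b, e, r, EuclideanSpace.inner_single_left, EuclideanSpace.inner_single_right,
      Pi.single_apply, eq_comm] using this
  have expand : ∀ {G : Type} [NormedAddCommGroup G] [NormedSpace ℝ G]
      (A : ContinuousMultilinearMap ℝ (fun _ : Fin m => RN N) G) (i : Fin m → Fin N),
      A (fun j => R (e (i j))) = ∑ k : Fin m → Fin N, (∏ j, r (i j) (k j)) • A (fun j => e (k j)) := by
    intro G _ _ A i
    simp_rw [hr]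
    rw [A.map_sum]
    exact Finset.sum_congr rfl fun k _ => A.map_smul_univ _ _
  -- The sum over tuples factors into a product of m one-index sums, each a Kronecker delta.
  have key : ∀ k l : Fin m → Fin N, ∑ i : Fin m → Fin N,
      (∏ j, r (i j) (k j)) * (∏ j, r (i j) (l j)) = if k = l then 1 else 0 := by
    intro k l
    simp_rw [← Finset.prod_mul_distrib]
    rw [← Fintype.piFinset_univ, ← Finset.prod_univ_sum (fun _ => Finset.univ)
      (fun j a => r a (k j) * r a (l j))]
    simp_rw [horth]
    by_cases h : k = l
    · simp [h]
    · rw [if_neg h]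
      obtain ⟨j, hj⟩ := Function.ne_iff.1 h
      exact Finset.prod_eq_zero (Finset.mem_univ j) (by simp [hj])
  change ∑ i : Fin m → Fin N, F (fun j => R (e (i j))) (fun j => R (e (i j))) =
    ∑ i : Fin m → Fin N, F (fun j => e (i j)) (fun j => e (i j))
  calc ∑ i : Fin m → Fin N, F (fun j => R (e (i j))) (fun j => R (e (i j)))
      = ∑ i : Fin m → Fin N, ∑ k : Fin m → Fin N, ∑ l : Fin m → Fin N,
          ((∏ j, r (i j) (k j)) * (∏ j, r (i j) (l j))) *
            F (fun j => e (k j)) (fun j => e (l j)) := by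
        refine Finset.sum_congr rfl fun i _ => ?_
        rw [expand F i, _root_.sum_apply]
        refine Finset.sum_congr rfl fun k _ => ?_
        rw [_root_.smul_apply, expand _ i, Finset.smul_sum]
        refine Finset.sum_congr rfl fun l _ => ?_
        simp only [smul_eq_mul]; ring
    _ = ∑ k : Fin m → Fin N, ∑ l : Fin m → Fin N, (∑ i : Fin m → Fin N,
          ((∏ j, r (i j) (k j)) * (∏ j, r (i j) (l j)))) *
            F (fun j => e (k j)) (fun j => e (l j)) := by
        rw [Finset.sum_comm]
        refine Finset.sum_congr rfl fun k _ => ?_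
        rw [Finset.sum_comm]
        refine Finset.sum_congr rfl fun l _ => ?_
        rw [Finset.sum_mul]
    _ = _ := by
        simp_rw [key]
        simp

/-- A rotation invariant function which is homogeneous of degree `-N` is a multiple
of `‖x‖ ^ (-N)`. -/
lemma exists_eq_div_norm_pow (hN : 1 ≤ N) (f : RN N → ℝ)
    (hrot : ∀ (R : RN N ≃ₗᵢ[ℝ] RN N) x, x ≠ 0 → f (R x) = f x)
    (hhom : ∀ (a : ℝ) x, 0 < a → x ≠ 0 → f (a • x) = (a ^ N)⁻¹ * f x) :
    ∃ κ, ∀ x, x ≠ 0 → f x = κ / ‖x‖ ^ N := by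
  let e : RN N := EuclideanSpace.single ⟨0, hN⟩ 1
  have he : ‖e‖ = 1 := by simp [e]
  have he0 : e ≠ 0 := norm_ne_zero_iff.1 (by simp [he])
  refine ⟨f e, fun x hx => ?_⟩
  have hx' : 0 < ‖x‖ := norm_pos_iff.2 hx
  have hnorm : ‖‖x‖ • e‖ = ‖x‖ := by simp [norm_smul, he]
  -- A reflection carries ‖x‖ e to x, so the value at x is determined by the value at e.
  have h1 := Submodule.reflection_sub hnorm
  rw [← h1, hrot _ _ (by simp [hx, he0]), hhom _ _ hx' he0, h1]
  field_simp

lemma logNorm_isometry (R : RN N ≃ₗᵢ[ℝ] RN N) (x : RN N) : logNorm N (R x) = logNorm N x := by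
  simp [logNorm]

lemma iteratedFDeriv_logNorm_isometry (R : RN N ≃ₗᵢ[ℝ] RN N) (x : RN N) (v : Fin m → RN N) :
    iteratedFDeriv ℝ m (logNorm N) (R x) (fun j => R (v j)) =
      iteratedFDeriv ℝ m (logNorm N) x v := by
  have := iteratedFDeriv_comp_equiv R.toContinuousLinearEquiv (logNorm N) x m
  simp only [LinearIsometryEquiv.coe_toContinuousLinearEquiv, logNorm_isometry] at this
  change iteratedFDeriv ℝ m (logNorm N) x = _ at this
  rw [this]; rfl

/-- A dilation only adds the constant log a to the logarithm, and a derivative of positive order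
kills it. -/
lemma partialDeriv_logNorm_smul (hm : m ≠ 0) {a : ℝ} (ha : 0 < a) {x : RN N} (hx : x ≠ 0)
    (i : Fin m → Fin N) :
    partialDeriv i (logNorm N) (a • x) = (a ^ m)⁻¹ * partialDeriv i (logNorm N) x := by
  have h1 := partialDeriv_comp_smul ha.ne' (logNorm N) x i
  have h2 : (fun y => logNorm N (a • y)) =ᶠ[nhds x] fun y => Real.log a + logNorm N y := by
    filter_upwards [isOpen_ne.mem_nhds hx] with y hy
    rw [logNorm, logNorm, norm_smul, Real.norm_of_nonneg ha.le,
      Real.log_mul ha.ne' (norm_ne_zero_iff.2 hy)]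
  rw [partialDeriv_congr h2, partialDeriv_add contDiffAt_const (contDiffAt_logNorm hx),
    partialDeriv_const hm, zero_add] at h1
  rw [h1]
  field_simp

/-- The norm of the gradient tensor of order `N` of the logarithm. -/
lemma exists_norm_gradTensor_logNorm (hN : 1 ≤ N) :
    ∃ κ, ∀ x : RN N, x ≠ 0 → ‖gradTensor N (logNorm N) x‖ = κ / ‖x‖ ^ N := by
  refine exists_eq_div_norm_pow hN _ (fun R x _ => ?_) (fun a x ha hx => ?_)
  · rw [EuclideanSpace.norm_eq, EuclideanSpace.norm_eq]
    congr 1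
    let A := iteratedFDeriv ℝ N (logNorm N) (R x)
    -- The squared norm of a tensor is the full contraction of its tensor square.
    have h := sum_contraction_isometry R (A.smulRight A)
    simp only [ContinuousMultilinearMap.smulRight_apply, _root_.smul_apply,
      smul_eq_mul, A, iteratedFDeriv_logNorm_isometry R x] at h
    simpa [partialDeriv, pow_two] using h.symm
  · have : gradTensor N (logNorm N) (a • x) = (a ^ N)⁻¹ • gradTensor N (logNorm N) x := by
      ext i
      simpa using partialDeriv_logNorm_smul (by omega) ha hx i
    rw [this, norm_smul, Real.norm_of_nonneg (by positivity)]

/-- Euler's identity for functions of negative degree. -/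
lemma fderiv_self_of_homogeneous {f : RN N → ℝ} {x : RN N} (hf : DifferentiableAt ℝ f x)
    (hhom : ∀ a : ℝ, 0 < a → f (a • x) = (a ^ m)⁻¹ * f x) : fderiv ℝ f x x = -m * f x := by
  have h1 : HasDerivAt (fun a : ℝ => f (a • x)) (fderiv ℝ f x x) 1 := by
    have hc : HasDerivAt (fun a : ℝ => a • x) ((1 : ℝ) • x) 1 := (hasDerivAt_id 1).smul_const x
    have hf' : HasFDerivAt f (fderiv ℝ f x) ((1 : ℝ) • x) := by simpa using hf.hasFDerivAt
    simpa [Function.comp_def] using hf'.comp_hasDerivAt (1 : ℝ) hc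
  have h2 : HasDerivAt (fun a : ℝ => (a ^ m)⁻¹ * f x) (-m * f x) 1 := by
    have := ((hasDerivAt_pow m (1 : ℝ)).fun_inv (by simp)).mul_const (f x)
    simpa using this
  refine h1.unique (h2.congr_of_eventuallyEq ?_)
  filter_upwards [lt_mem_nhds (zero_lt_one : (0 : ℝ) < 1)] with a ha using hhom a ha

/-- Euler's identity: contracting with x lowers the order of the derivative by one, at the cost of a
nonzero factor. -/
lemma sum_coord_mul_partialDeriv_logNorm (hm : m ≠ 0) {x : RN N} (hx : x ≠ 0)
    (i : Fin m → Fin N) :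
    ∑ p, x p * partialDeriv (Fin.cons p i : Fin (m + 1) → Fin N) (logNorm N) x =
      -m * partialDeriv i (logNorm N) x := by
  simp_rw [partialDeriv_cons (contDiffAt_logNorm hx)]
  rw [sum_coord_mul_clm]
  exact fderiv_self_of_homogeneous
    (((contDiffAt_logNorm hx).partialDeriv i).differentiableAt (by norm_num))
    fun a ha => partialDeriv_logNorm_smul hm ha hx i

lemma fderiv_logNorm {x : RN N} (hx : x ≠ 0) (v : RN N) :
    fderiv ℝ (logNorm N) x v = inner ℝ x v / ‖x‖ ^ 2 := by
  have h : logNorm N = fun y : RN N => (1 / 2) * Real.log (‖y‖ ^ 2) := by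
    ext y; rw [logNorm, Real.log_pow]; push_cast; ring
  have h1 : HasFDerivAt (fun y : RN N => ‖y‖ ^ 2) (2 • innerSL ℝ x) x :=
    (hasStrictFDerivAt_norm_sq x).hasFDerivAt
  have h2 := ((h1.log (by simpa using hx)).const_mul (1 / 2 : ℝ))
  rw [h, h2.fderiv]
  simp
  ring

/-- By Euler's identity, vanishing at order m + 1 would propagate to order m, and so down to the
first gradient x/|x|². -/
lemma gradTensor_logNorm_ne_zero (hm : 1 ≤ m) {x : RN N} (hx : x ≠ 0) :
    gradTensor m (logNorm N) x ≠ 0 := by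
  induction m, hm using Nat.le_induction with
  | base =>
    intro h
    have h1 : ∀ p, fderiv ℝ (logNorm N) x (EuclideanSpace.single p 1) = 0 := fun p => by
      have : gradTensor 1 (logNorm N) x (fun _ => p) = 0 := by rw [h]; rfl
      simpa [partialDeriv] using this
    have h2 := sum_coord_mul_clm (fderiv ℝ (logNorm N) x) x
    simp [h1, fderiv_logNorm hx, hx] at h2
  | succ m hm ih =>
    intro h
    refine ih ?_
    ext i
    have h1 := sum_coord_mul_partialDeriv_logNorm (by omega) hx i
    have h2 : ∀ p, partialDeriv (Fin.cons p i : Fin (m + 1) → Fin N) (logNorm N) x = 0 :=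
      fun p => by rw [← gradTensor_apply, h]; rfl
    simp only [h2, mul_zero, Finset.sum_const_zero] at h1
    have h3 : (m : ℝ) ≠ 0 := by positivity
    simpa [h3, eq_comm] using h1

end

/-! ### The kernel and its divergence of order N. -/

/-- The tensor field `‖x‖ ^ N ∇ ^ N log ‖x‖`, homogeneous of degree zero. -/
noncomputable def kernel (N : ℕ) (x : RN N) : EuclideanSpace ℝ (Fin N → Fin N) :=
  ‖x‖ ^ N • gradTensor N (logNorm N) x

section

variable {N m : ℕ}

lemma kernel_apply (x : RN N) (i : Fin N → Fin N) :
    kernel N x i = ‖x‖ ^ N * partialDeriv i (logNorm N) x := rfl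

lemma kernel_smul (hN : 1 ≤ N) {a : ℝ} (ha : 0 < a) (x : RN N) :
    kernel N (a • x) = kernel N x := by
  rcases eq_or_ne x 0 with rfl | hx
  · simp
  · ext i
    rw [kernel_apply, kernel_apply, partialDeriv_logNorm_smul (by omega) ha hx, norm_smul,
      Real.norm_of_nonneg ha.le, mul_pow]
    field_simp

lemma contDiffAt_norm_pow {x : RN N} (hx : x ≠ 0) (k : ℕ) :
    ContDiffAt ℝ ∞ (fun y : RN N => ‖y‖ ^ k) x := (contDiffAt_norm ℝ hx).pow k

lemma contDiffAt_kernel_apply {x : RN N} (hx : x ≠ 0) (i : Fin N → Fin N) :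
    ContDiffAt ℝ ∞ (fun y => kernel N y i) x :=
  (contDiffAt_norm_pow hx N).mul ((contDiffAt_logNorm hx).partialDeriv i)

lemma exists_norm_kernel_le (hN : 1 ≤ N) : ∃ s, ∀ x : RN N, ‖kernel N x‖ ≤ s := by
  obtain ⟨s, hs⟩ := exists_norm_gradTensor_logNorm hN
  refine ⟨|s|, fun x => ?_⟩
  rcases eq_or_ne x 0 with rfl | hx
  · simp [kernel, show N ≠ 0 by omega]
  · have : 0 < ‖x‖ := norm_pos_iff.2 hx
    rw [kernel, norm_smul, hs x hx, norm_pow, norm_norm]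
    field_simp
    exact le_abs_self s

lemma continuousAt_kernel {x : RN N} (hx : x ≠ 0) : ContinuousAt (kernel N) x := by
  have h : ContinuousAt (fun y => (fun i => kernel N y i : (Fin N → Fin N) → ℝ)) x :=
    continuousAt_pi.2 fun i => (contDiffAt_kernel_apply hx i).continuousAt
  exact (PiLp.continuous_toLp 2 _).continuousAt.comp h

lemma measurable_kernel : Measurable (kernel N) :=
  measurable_of_continuousOn_compl_singleton 0
    fun _ hx => (continuousAt_kernel hx).continuousWithinAt

lemma continuous_gradTensor {u : RN N → ℝ} (hu : ContDiff ℝ ∞ u) : Continuous (gradTensor m u) := by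
  have h : Continuous (fun y => (fun i => partialDeriv i u y : (Fin m → Fin N) → ℝ)) :=
    continuous_pi fun i => (hu.partialDeriv i).continuous
  exact (PiLp.continuous_toLp 2 _).comp h

lemma HasCompactSupport.gradTensor {u : RN N → ℝ} (hs : HasCompactSupport u) :
    HasCompactSupport (gradTensor m u) := by
  refine (hs.iteratedFDeriv (𝕜 := ℝ) m).mono fun x hx => ?_
  contrapose! hx
  simp only [Function.mem_support, ne_eq, not_not] at hx ⊢
  ext i
  simp [_root_.gradTensor, _root_.partialDeriv, hx]

lemma integrable_gradTensor {u : RN N → ℝ} (hu : ContDiff ℝ ∞ u) (hs : HasCompactSupport u) :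
    Integrable (gradTensor m u) volume :=
  (continuous_gradTensor hu).integrable_of_hasCompactSupport hs.gradTensor

lemma inner_gradTensor (u : RN N → ℝ) (x : RN N) (v : EuclideanSpace ℝ (Fin m → Fin N)) :
    inner ℝ (gradTensor m u x) v = ∑ i, partialDeriv i u x * v i := by
  simp [PiLp.inner_apply, mul_comm]

lemma sphereArea_pos (hN : 1 ≤ N) : 0 < sphereArea N := by
  have : Nonempty (Fin N) := ⟨⟨0, hN⟩⟩
  rw [sphereArea, Measure.toSphere_real_apply_univ]
  have h1 : 0 < (volume : Measure (RN N)).real (Metric.ball 0 1) :=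
    ENNReal.toReal_pos (Metric.measure_ball_pos _ _ one_pos).ne' measure_ball_lt_top.ne
  have h2 : 0 < Module.finrank ℝ (RN N) := by simp; omega
  positivity

/-- The annulus `1 < ‖x‖ ≤ M`. -/
def annulus (N : ℕ) (M : ℝ) : Set (RN N) := {x | 1 < ‖x‖ ∧ ‖x‖ ≤ M}

lemma measurableSet_annulus (M : ℝ) : MeasurableSet (annulus N M) :=
  (measurableSet_lt measurable_const measurable_norm).inter
    (measurableSet_le measurable_norm measurable_const)

/-- The polar density r^(N-1) turns r^(-N) into 1/r, the source of every logarithm below. -/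
lemma radial_integrand_eq (hN : 1 ≤ N) (M : ℝ) (y : ℝ) :
    y ^ (N - 1) • (Set.Ioc 1 M).indicator (fun r => (r ^ N)⁻¹) y =
      (Set.Ioc 1 M).indicator (fun r => r⁻¹) y := by
  by_cases hy : y ∈ Set.Ioc 1 M
  · have : y ≠ 0 := by linarith [hy.1]
    obtain ⟨k, rfl⟩ : ∃ k, N = k + 1 := ⟨N - 1, by omega⟩
    simp only [Set.indicator_of_mem hy, smul_eq_mul, Nat.add_sub_cancel]
    field_simp
    ring
  · simp [Set.indicator_of_notMem hy]

lemma integrableOn_inv_Ioc (M : ℝ) : IntegrableOn (fun r : ℝ => r⁻¹) (Set.Ioc 1 M) := by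
  refine IntegrableOn.mono_set (t := Set.Icc 1 M) ?_ Set.Ioc_subset_Icc_self
  refine ContinuousOn.integrableOn_Icc fun r hr => ?_
  exact (continuousAt_inv₀ (by linarith [hr.1])).continuousWithinAt

lemma annulus_indicator (M : ℝ) (g : ℝ → ℝ) (x : RN N) : (annulus N M).indicator
    (fun x => g ‖x‖) x = (Set.Ioc 1 M).indicator g ‖x‖ := by
  simp [annulus, Set.indicator_apply]

lemma integrableOn_annulus (hN : 1 ≤ N) (M : ℝ) :
    IntegrableOn (fun x : RN N => (‖x‖ ^ N)⁻¹) (annulus N M) := by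
  have : Nonempty (Fin N) := ⟨⟨0, hN⟩⟩
  rw [← integrable_indicator_iff (measurableSet_annulus M)]
  rw [show (annulus N M).indicator (fun x => (‖x‖ ^ N)⁻¹) =
    fun x => (Set.Ioc 1 M).indicator (fun r => (r ^ N)⁻¹) ‖x‖ from
    funext (annulus_indicator M (fun r => (r ^ N)⁻¹))]
  rw [integrable_fun_norm_addHaar volume (f := (Set.Ioc 1 M).indicator (fun r => (r ^ N)⁻¹))]
  simp only [finrank_euclideanSpace, Fintype.card_fin, radial_integrand_eq hN]
  exact ((integrable_indicator_iff measurableSet_Ioc).2 (integrableOn_inv_Ioc M)).integrableOn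

lemma integral_annulus (hN : 1 ≤ N) {M : ℝ} (hM : 1 ≤ M) :
    ∫ x in annulus N M, (‖x‖ ^ N)⁻¹ = sphereArea N * Real.log M := by
  have : Nonempty (Fin N) := ⟨⟨0, hN⟩⟩
  rw [← integral_indicator (measurableSet_annulus M)]
  rw [show (annulus N M).indicator (fun x => (‖x‖ ^ N)⁻¹) =
    fun x => (Set.Ioc 1 M).indicator (fun r => (r ^ N)⁻¹) ‖x‖ from
    funext (annulus_indicator M (fun r => (r ^ N)⁻¹))]
  rw [integral_fun_norm_addHaar volume ((Set.Ioc 1 M).indicator (fun r => (r ^ N)⁻¹)),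
    sphereArea, Measure.toSphere_real_apply_univ]
  simp only [finrank_euclideanSpace, Fintype.card_fin, radial_integrand_eq hN]
  rw [setIntegral_indicator measurableSet_Ioc, Set.inter_eq_right.2
    (show Set.Ioc 1 M ⊆ Set.Ioi 0 from fun r hr => lt_trans zero_lt_one hr.1), ← intervalIntegral.integral_of_le hM,
    integral_inv_of_pos one_pos (by linarith)]
  simp [mul_assoc]

/-- The divergence of order `N` of the kernel. -/
noncomputable def kernelDiv (N : ℕ) (x : RN N) : ℝ :=
  ∑ i : Fin N → Fin N, partialDeriv i (fun y => kernel N y i) x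

/-- The divergence is the full contraction of the N-th derivative of an isometry-equivariant tensor
field, hence rotation invariant; N derivatives of a field of degree 0 have degree -N. -/
lemma exists_kernelDiv_eq (hN : 1 ≤ N) :
    ∃ κ, ∀ x : RN N, x ≠ 0 → kernelDiv N x = κ / ‖x‖ ^ N := by
  refine exists_eq_div_norm_pow hN _ (fun R x hx => ?_) (fun a x ha hx => ?_)
  · let T : RN N → ContinuousMultilinearMap ℝ (fun _ : Fin N => RN N) ℝ :=
      fun y => ‖y‖ ^ N • iteratedFDeriv ℝ N (logNorm N) y
    have hT : ∀ y, y ≠ 0 → ContDiffAt ℝ ∞ T y := fun y hy =>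
      (contDiffAt_norm_pow hy N).smul ((contDiffAt_logNorm hy).iteratedFDeriv_right (by norm_cast))
    have hTR : ∀ y v, T (R y) (fun j => R (v j)) = T y v := fun y v => by
      simp [T, iteratedFDeriv_logNorm_isometry]
    have happ : ∀ y, y ≠ 0 → ∀ v w : Fin N → RN N, iteratedFDeriv ℝ N (fun z => T z v) y w =
        iteratedFDeriv ℝ N T y w v := fun y hy v w =>
      iteratedFDeriv_clm_apply_left (hT y hy)
        (ContinuousMultilinearMap.apply ℝ (fun _ : Fin N => RN N) ℝ v) N w
    have hRx : R x ≠ 0 := by simpa using hx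
    have hdiv : ∀ y, y ≠ 0 → kernelDiv N y = ∑ i : Fin N → Fin N, iteratedFDeriv ℝ N T y
        (fun j => EuclideanSpace.single (i j) 1) (fun j => EuclideanSpace.single (i j) 1) :=
      fun y hy => Finset.sum_congr rfl fun i _ => happ y hy _ _
    rw [hdiv _ hRx, hdiv _ hx, ← sum_contraction_isometry R]
    refine Finset.sum_congr rfl fun i _ => ?_
    rw [← happ _ hRx, ← happ _ hx]
    have h := iteratedFDeriv_comp_equiv R.toContinuousLinearEquiv
      (fun z => T z (fun j => R (EuclideanSpace.single (i j) 1))) x N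
    simp only [LinearIsometryEquiv.coe_toContinuousLinearEquiv, hTR] at h
    rw [h]; rfl
  · rw [kernelDiv, kernelDiv, Finset.mul_sum]
    refine Finset.sum_congr rfl fun i _ => ?_
    have h := partialDeriv_comp_smul ha.ne' (fun y => kernel N y i) x i
    simp only [kernel_smul hN ha] at h
    rw [h]
    field_simp

/-- The kernel, truncated smoothly near the origin. -/
noncomputable def truncKernel (N : ℕ) (x : RN N) : EuclideanSpace ℝ (Fin N → Fin N) :=
  (1 - cutoff N x) • kernel N x

lemma truncKernel_apply (x : RN N) (i : Fin N → Fin N) :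
    truncKernel N x i = (1 - cutoff N x) * kernel N x i := rfl

lemma contDiff_cutoff (N : ℕ) : ContDiff ℝ ∞ (cutoff N) := (cutoff N).contDiff

lemma cutoff_eq_one {x : RN N} (hx : ‖x‖ ≤ 1 / 2) : cutoff N x = 1 :=
  (cutoff N).one_of_mem_closedBall (mem_closedBall_zero_iff.2 hx)

lemma cutoff_eq_zero {x : RN N} (hx : 1 ≤ ‖x‖) : cutoff N x = 0 :=
  (cutoff N).zero_of_le_dist (by rw [dist_zero_right]; exact hx)

lemma cutoff_eventually_eq_one (N : ℕ) : ∀ᶠ x in nhds (0 : RN N), cutoff N x = 1 := by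
  filter_upwards [Metric.ball_mem_nhds (0 : RN N) (by norm_num : (0 : ℝ) < 1 / 2)] with x hx
  exact cutoff_eq_one (mem_ball_zero_iff.1 hx).le

lemma cutoff_eventually_eq_zero {x : RN N} (hx : 1 < ‖x‖) : ∀ᶠ y in nhds x, cutoff N y = 0 := by
  filter_upwards [(isOpen_lt continuous_const continuous_norm).mem_nhds hx] with y hy
  exact cutoff_eq_zero (le_of_lt hy)

/-- The factor vanishes identically near the only possible singularity. -/
lemma contDiff_one_sub_cutoff_mul {f : RN N → ℝ} (hf : ∀ x, x ≠ 0 → ContDiffAt ℝ ∞ f x) :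
    ContDiff ℝ ∞ (fun x => (1 - cutoff N x) * f x) := by
  refine contDiff_iff_contDiffAt.2 fun x => ?_
  rcases eq_or_ne x 0 with rfl | hx
  · refine (contDiffAt_const (c := (0 : ℝ))).congr_of_eventuallyEq ?_
    filter_upwards [cutoff_eventually_eq_one N] with y hy
    simp [hy]
  · exact (contDiffAt_const.sub (contDiff_cutoff N).contDiffAt).mul (hf x hx)

lemma contDiff_truncKernel_apply (i : Fin N → Fin N) :
    ContDiff ℝ ∞ (fun x => truncKernel N x i) :=
  contDiff_one_sub_cutoff_mul fun _ hx => contDiffAt_kernel_apply hx i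

/-- The divergence of order `N` of the truncated kernel. -/
noncomputable def truncDiv (N : ℕ) (x : RN N) : ℝ :=
  ∑ i : Fin N → Fin N, partialDeriv i (fun y => truncKernel N y i) x

lemma continuous_truncDiv : Continuous (truncDiv N) :=
  continuous_finsetSum _ fun i _ => ((contDiff_truncKernel_apply i).partialDeriv i).continuous

lemma truncDiv_eq_kernelDiv {x : RN N} (hx : 1 < ‖x‖) : truncDiv N x = kernelDiv N x := by
  refine Finset.sum_congr rfl fun i _ => partialDeriv_congr ?_ i
  filter_upwards [cutoff_eventually_eq_zero hx] with y hy
  simp [truncKernel_apply, hy]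

/-- Under x = εy the Jacobian ε^N is absorbed by the N derivatives of u, and the kernel, of degree
0, does not change. All dependence on ε then sits in the argument of u. -/
lemma integral_inner_truncKernel (hN : 1 ≤ N) {u : RN N → ℝ} (hu : ContDiff ℝ ∞ u)
    (hs : HasCompactSupport u) {ε : ℝ} (hε : 0 < ε) :
    ∫ x, inner ℝ (gradTensor N u x) ((1 - cutoff N (ε⁻¹ • x)) • kernel N x) =
      (-1) ^ N * ∫ y, u (ε • y) * truncDiv N y := by
  have hw : ContDiff ℝ ∞ (fun y => u (ε • y)) := hu.comp (contDiff_const_smul ε)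
  have hws : HasCompactSupport (fun y => u (ε • y)) := hs.comp_smul hε.ne'
  have h1 : ∫ y, u (ε • y) * truncDiv N y =
      ∑ i : Fin N → Fin N, ∫ y, u (ε • y) * partialDeriv i (fun y => truncKernel N y i) y := by
    simp_rw [truncDiv, Finset.mul_sum]
    exact integral_finsetSum _ fun i _ =>
      (hw.continuous.mul ((contDiff_truncKernel_apply i).partialDeriv i).continuous
        ).integrable_of_hasCompactSupport hws.mul_right
  have h2 : ∀ i : Fin N → Fin N,
      (-1) ^ N * ∫ y, u (ε • y) * partialDeriv i (fun y => truncKernel N y i) y =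
      ∫ y, partialDeriv i (fun y => u (ε • y)) y * truncKernel N y i := fun i =>
    (integral_partialDeriv_mul hw hws (contDiff_truncKernel_apply i) i).symm
  have h3 := Measure.integral_comp_smul (volume : Measure (RN N))
    (fun x => inner ℝ (gradTensor N u x) ((1 - cutoff N (ε⁻¹ • x)) • kernel N x)) ε
  simp only [smul_smul, inv_mul_cancel₀ hε.ne', one_smul, kernel_smul hN hε,
    finrank_euclideanSpace, Fintype.card_fin, smul_eq_mul] at h3
  rw [abs_of_pos (by positivity), eq_inv_mul_iff_mul_eq₀ (by positivity)] at h3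
  rw [← h3, h1, Finset.mul_sum]
  simp_rw [h2]
  have h4 : ∀ i ∈ Finset.univ, Integrable
      (fun y => partialDeriv i (fun y => u (ε • y)) y * truncKernel N y i) volume := fun i _ =>
    ((hw.partialDeriv i).continuous.mul (contDiff_truncKernel_apply i).continuous
      ).integrable_of_hasCompactSupport (hws.partialDeriv i).mul_right
  rw [← integral_finsetSum _ h4, ← integral_const_mul]
  refine integral_congr_ae (.of_forall fun y => ?_)
  simp only [inner_gradTensor, Finset.mul_sum, partialDeriv_comp_smul hε.ne', truncKernel,
    mul_assoc]

/-- Smooth compactly supported functions are recovered from their derivatives of order `N`,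
up to a constant. -/
lemma exists_integral_inner_kernel (hN : 1 ≤ N) : ∃ c : ℝ, ∀ u : RN N → ℝ, ContDiff ℝ ∞ u →
    HasCompactSupport u → ∫ x, inner ℝ (gradTensor N u x) (kernel N x) = c * u 0 := by
  obtain ⟨s, hs⟩ := exists_norm_kernel_le hN
  have hcut : ∀ x : RN N, |1 - cutoff N x| ≤ 1 := fun x =>
    abs_le.2 ⟨by linarith [(cutoff N).le_one (x := x)], by linarith [(cutoff N).nonneg (x := x)]⟩
  have hbound : ∀ (u : RN N → ℝ) (ε : ℝ) (x : RN N),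
      ‖inner ℝ (gradTensor N u x) ((1 - cutoff N (ε⁻¹ • x)) • kernel N x)‖ ≤
        ‖gradTensor N u x‖ * s := fun u ε x => by
    refine (norm_inner_le_norm _ _).trans ?_
    gcongr
    rw [norm_smul]
    exact (mul_le_of_le_one_left (norm_nonneg _) (hcut _)).trans (hs x)
  -- The coefficient κ must vanish: integrating against dilated cutoffs yields at least |κ| ω log M
  -- up to a bounded term, while integration by parts bounds the same integrals uniformly.
  have hdiv0 : ∀ x : RN N, 1 < ‖x‖ → truncDiv N x = 0 := by
    obtain ⟨κ, hκ⟩ := exists_kernelDiv_eq hN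
    have hH : ∀ x : RN N, 1 < ‖x‖ → truncDiv N x = κ * (‖x‖ ^ N)⁻¹ := fun x hx => by
      rw [truncDiv_eq_kernelDiv hx, hκ x (by rintro rfl; norm_num at hx), div_eq_mul_inv]
    suffices κ = 0 by intro x hx; rw [hH x hx, this, zero_mul]
    by_contra hκ0
    have hu := contDiff_cutoff N
    have hus := (cutoff N).hasCompactSupport
    have hupper : ∀ ε : ℝ, 0 < ε → |∫ y, cutoff N (ε • y) * truncDiv N y| ≤
        ∫ x, ‖gradTensor N (cutoff N) x‖ * s := fun ε hε => by
      have h := integral_inner_truncKernel hN hu hus hε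
      have h' : |∫ y, cutoff N (ε • y) * truncDiv N y| =
        ‖∫ x, inner ℝ (gradTensor N (cutoff N) x) ((1 - cutoff N (ε⁻¹ • x)) • kernel N x)‖ := by
        rw [h, norm_mul]; simp
      rw [h']
      exact norm_integral_le_of_norm_le ((integrable_gradTensor hu hus).norm.mul_const s)
        (.of_forall fun x => hbound _ _ _)
    let B : ℝ := (∫ x, ‖gradTensor N (cutoff N) x‖ * s) +
      ∫ y in Metric.closedBall (0 : RN N) 1, |truncDiv N y|
    have hlog : ∀ M : ℝ, 1 ≤ M → |κ| * (sphereArea N * Real.log M) ≤ B := by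
      intro M hM
      -- This dilation makes the cutoff equal to one on ‖y‖ ≤ M.
      have hε : 0 < 1 / (2 * M) := by positivity
      have hint : Integrable (fun y => cutoff N ((1 / (2 * M)) • y) * truncDiv N y) volume :=
        ((hu.comp (contDiff_const_smul _)).continuous.mul
          continuous_truncDiv).integrable_of_hasCompactSupport (hus.comp_smul hε.ne').mul_right
      have hsplit := integral_add_compl (μ := volume)
        (measurableSet_closedBall (x := (0 : RN N)) (ε := 1)) hint
      have hin : |∫ y in Metric.closedBall (0 : RN N) 1,
          cutoff N ((1 / (2 * M)) • y) * truncDiv N y| ≤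
          ∫ y in Metric.closedBall (0 : RN N) 1, |truncDiv N y| := by
        rw [← Real.norm_eq_abs]
        refine norm_integral_le_of_norm_le (continuous_truncDiv.abs.continuousOn.integrableOn_compact
          (μ := volume) (isCompact_closedBall (0 : RN N) 1)) (.of_forall fun y => ?_)
        rw [norm_mul]
        refine mul_le_of_le_one_left (norm_nonneg _) ?_
        rw [Real.norm_of_nonneg (cutoff N).nonneg]
        exact (cutoff N).le_one
      have hmem : ∀ y ∈ (Metric.closedBall (0 : RN N) 1)ᶜ, 1 < ‖y‖ := fun y hy => by simpa using hy
      have hout : ∫ y in (Metric.closedBall (0 : RN N) 1)ᶜ,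
          cutoff N ((1 / (2 * M)) • y) * truncDiv N y =
          κ * ∫ y in (Metric.closedBall (0 : RN N) 1)ᶜ,
            cutoff N ((1 / (2 * M)) • y) * (‖y‖ ^ N)⁻¹ := by
        rw [← integral_const_mul]
        refine setIntegral_congr_fun measurableSet_closedBall.compl fun y hy => ?_
        simp only [hH y (hmem y hy)]
        ring
      have hint' : IntegrableOn (fun y => cutoff N ((1 / (2 * M)) • y) * (‖y‖ ^ N)⁻¹)
          (Metric.closedBall (0 : RN N) 1)ᶜ := by
        refine ((hint.const_mul κ⁻¹).integrableOn (s := (Metric.closedBall (0 : RN N) 1)ᶜ)).congr_fun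
          (fun y hy => ?_) measurableSet_closedBall.compl
        simp only [hH y (hmem y hy)]
        field_simp
      have hlow : sphereArea N * Real.log M ≤ ∫ y in (Metric.closedBall (0 : RN N) 1)ᶜ,
            cutoff N ((1 / (2 * M)) • y) * (‖y‖ ^ N)⁻¹ := by
        rw [← integral_annulus hN hM]
        have hsub : annulus N M ⊆ (Metric.closedBall (0 : RN N) 1)ᶜ := fun y hy => by
          simpa using hy.1
        calc ∫ y in annulus N M, (‖y‖ ^ N)⁻¹
            = ∫ y in annulus N M, cutoff N ((1 / (2 * M)) • y) * (‖y‖ ^ N)⁻¹ := by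
              refine setIntegral_congr_fun (measurableSet_annulus M) fun y hy => ?_
              have : ‖(1 / (2 * M)) • y‖ ≤ 1 / 2 := by
                rw [norm_smul, Real.norm_of_nonneg hε.le, div_mul_eq_mul_div, one_mul,
                  div_le_iff₀ (by positivity)]
                linarith [hy.2]
              simp only [cutoff_eq_one this, one_mul]
          _ ≤ _ := setIntegral_mono_set hint' (.of_forall fun y =>
                mul_nonneg (cutoff N).nonneg (by positivity)) (.of_forall hsub)
      have h1 := hupper _ hε
      rw [← hsplit, hout] at h1
      have hnn : 0 ≤ ∫ y in (Metric.closedBall (0 : RN N) 1)ᶜ,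
            cutoff N ((1 / (2 * M)) • y) * (‖y‖ ^ N)⁻¹ :=
        (mul_nonneg (sphereArea_pos hN).le (Real.log_nonneg hM)).trans hlow
      set I := ∫ y in (Metric.closedBall (0 : RN N) 1)ᶜ,
            cutoff N ((1 / (2 * M)) • y) * (‖y‖ ^ N)⁻¹
      set J := ∫ y in Metric.closedBall (0 : RN N) 1, cutoff N ((1 / (2 * M)) • y) * truncDiv N y
      calc |κ| * (sphereArea N * Real.log M) ≤ |κ| * I := by gcongr
        _ = |κ * I| := by rw [abs_mul, abs_of_nonneg hnn]
        _ = |(J + κ * I) - J| := by ring_nf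
        _ ≤ |J + κ * I| + |J| := abs_sub _ _
        _ ≤ B := add_le_add h1 hin
    have hω := sphereArea_pos hN
    have hκpos : 0 < |κ| := abs_pos.2 hκ0
    have htend := Real.tendsto_log_atTop.eventually_gt_atTop (B / (|κ| * sphereArea N))
    obtain ⟨M, hM1, hM2⟩ := (htend.and (Filter.eventually_ge_atTop 1)).exists
    rw [div_lt_iff₀ (by positivity)] at hM1
    linarith [hlog M hM2]
  have hHs : HasCompactSupport (truncDiv N) :=
    .intro (isCompact_closedBall (0 : RN N) 1) fun x hx => hdiv0 x (by simpa using hx)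
  have hHint : Integrable (truncDiv N) volume :=
    continuous_truncDiv.integrable_of_hasCompactSupport hHs
  -- The truncated divergence is now compactly supported, and its total mass gives the constant: as
  -- ε → 0 the truncation disappears on one side and u(εy) tends to u(0) on the other.
  refine ⟨(-1) ^ N * ∫ y, truncDiv N y, fun u hu hus => ?_⟩
  let ε : ℕ → ℝ := fun n => 1 / ((n : ℝ) + 1)
  have hε : ∀ n, 0 < ε n := fun n => by positivity
  have hlim : Filter.Tendsto ε Filter.atTop (nhds 0) := tendsto_one_div_add_atTop_nhds_zero_nat
  obtain ⟨Cu, hCu⟩ := hu.continuous.bounded_above_of_compact_support hus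
  have l1 : Filter.Tendsto (fun n => ∫ x, inner ℝ (gradTensor N u x)
      ((1 - cutoff N ((ε n)⁻¹ • x)) • kernel N x)) Filter.atTop
      (nhds (∫ x, inner ℝ (gradTensor N u x) (kernel N x))) := by
    refine tendsto_integral_of_dominated_convergence (fun x => ‖gradTensor N u x‖ * s) ?_
      ((integrable_gradTensor hu hus).norm.mul_const s) (fun n => .of_forall (hbound u (ε n))) ?_
    · intro n
      refine (continuous_gradTensor hu).aestronglyMeasurable.inner ?_
      exact ((continuous_const.sub ((contDiff_cutoff N).continuous.comp
        (continuous_const_smul _))).measurable.smul measurable_kernel).aestronglyMeasurable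
    · have : Nontrivial (RN N) := by
        have : Nonempty (Fin N) := ⟨⟨0, hN⟩⟩
        infer_instance
      filter_upwards [compl_mem_ae_iff.2 (measure_singleton (0 : RN N))] with x hx
      refine tendsto_const_nhds.congr' ?_
      have hxpos : 0 < ‖x‖ := norm_pos_iff.2 hx
      filter_upwards [hlim.eventually (ge_mem_nhds hxpos)] with n hn
      have : 1 ≤ ‖(ε n)⁻¹ • x‖ := by
        rw [norm_smul, norm_inv, Real.norm_of_nonneg (hε n).le, inv_mul_eq_div, le_div_iff₀ (hε n)]
        simpa using hn
      rw [cutoff_eq_zero this]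
      simp
  have l2 : Filter.Tendsto (fun n => ∫ y, u (ε n • y) * truncDiv N y) Filter.atTop
      (nhds (∫ y, u 0 * truncDiv N y)) := by
    refine tendsto_integral_of_dominated_convergence (fun y => Cu * ‖truncDiv N y‖) ?_
      (hHint.norm.const_mul Cu) ?_ ?_
    · exact fun n => ((hu.continuous.comp (continuous_const_smul _)).mul
        continuous_truncDiv).aestronglyMeasurable
    · refine fun n => .of_forall fun y => ?_
      rw [norm_mul]
      gcongr
      exact hCu _
    · refine .of_forall fun y => Filter.Tendsto.mul_const _ ?_
      refine (hu.continuous.tendsto 0).comp ?_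
      simpa using hlim.smul_const y
  simp_rw [fun n => integral_inner_truncKernel hN hu hus (hε n)] at l1
  rw [integral_const_mul] at l2
  rw [tendsto_nhds_unique l1 (l2.const_mul _)]
  ring

end

/-! ### Logarithmic cutoffs: the value of the constant and sharpness. -/

section

variable {N m : ℕ}

lemma norm_kernel {s : ℝ}
    (hs : ∀ x : RN N, x ≠ 0 → ‖gradTensor N (logNorm N) x‖ = s / ‖x‖ ^ N) {x : RN N}
    (hx : x ≠ 0) : ‖kernel N x‖ = s := by
  have : 0 < ‖x‖ := norm_pos_iff.2 hx
  rw [kernel, norm_smul, hs x hx, norm_pow, norm_norm]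
  field_simp

lemma norm_kernel_le (hN : 1 ≤ N) {s : ℝ} (hs0 : 0 ≤ s)
    (hs : ∀ x : RN N, x ≠ 0 → ‖gradTensor N (logNorm N) x‖ = s / ‖x‖ ^ N) (x : RN N) :
    ‖kernel N x‖ ≤ s := by
  rcases eq_or_ne x 0 with rfl | hx
  · simpa [kernel, show N ≠ 0 by omega] using hs0
  · exact (norm_kernel hs hx).le

/-- The logarithm, truncated smoothly near the origin. -/
noncomputable def truncLog (N : ℕ) (x : RN N) : ℝ := (1 - cutoff N x) * logNorm N x

lemma contDiff_truncLog : ContDiff ℝ ∞ (truncLog N) :=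
  contDiff_one_sub_cutoff_mul fun _ hx => contDiffAt_logNorm hx

lemma gradTensor_truncLog {x : RN N} (hx : 1 < ‖x‖) :
    gradTensor m (truncLog N) x = gradTensor m (logNorm N) x := by
  ext i
  refine partialDeriv_congr ?_ i
  filter_upwards [cutoff_eventually_eq_zero hx] with y hy
  simp [truncLog, hy]

/-- A logarithmic cutoff between the radii `1` and `M`. -/
noncomputable def logCutoff (N : ℕ) (M : ℝ) (x : RN N) : ℝ :=
  1 + -(Real.log M)⁻¹ * (truncLog N x + -1 * truncLog N (M⁻¹ • x))

lemma contDiff_truncLog_smul (a : ℝ) : ContDiff ℝ ∞ (fun x => truncLog N (a • x)) :=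
  contDiff_truncLog.comp (contDiff_const_smul a)

lemma contDiff_logCutoff (M : ℝ) : ContDiff ℝ ∞ (logCutoff N M) :=
  contDiff_const.add (contDiff_const.mul
    (contDiff_truncLog.add (contDiff_const.mul (contDiff_truncLog_smul _))))

/-- Beyond radius M the two truncated logarithms differ by exactly log M. -/
lemma hasCompactSupport_logCutoff {M : ℝ} (hM : 1 < M) : HasCompactSupport (logCutoff N M) := by
  refine .intro (isCompact_closedBall (0 : RN N) M) fun x hx => ?_
  have hx' : M < ‖x‖ := by simpa using hx
  have h2 : 1 ≤ ‖M⁻¹ • x‖ := by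
    rw [norm_smul, norm_inv, Real.norm_of_nonneg (by linarith), inv_mul_eq_div,
      le_div_iff₀ (by linarith)]
    linarith
  have hlog : Real.log M ≠ 0 := (Real.log_pos hM).ne'
  rw [logCutoff, truncLog, truncLog, cutoff_eq_zero (by linarith), cutoff_eq_zero h2, logNorm,
    logNorm, norm_smul, norm_inv, Real.norm_of_nonneg (by linarith),
    Real.log_mul (by positivity) (by linarith), Real.log_inv]
  field_simp
  ring

lemma logCutoff_eventually_eq_one {M : ℝ} (hM : 1 < M) :
    ∀ᶠ x in nhds (0 : RN N), logCutoff N M x = 1 := by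
  filter_upwards [Metric.ball_mem_nhds (0 : RN N) (by norm_num : (0 : ℝ) < 1 / 2)] with x hx
  have h1 : ‖x‖ ≤ 1 / 2 := (mem_ball_zero_iff.1 hx).le
  have h2 : ‖M⁻¹ • x‖ ≤ 1 / 2 := by
    rw [norm_smul, norm_inv, Real.norm_of_nonneg (by linarith), inv_mul_eq_div,
      div_le_iff₀ (by linarith)]
    linarith
  simp [logCutoff, truncLog, cutoff_eq_one h1, cutoff_eq_one h2]

/-- The part of the gradient tensor of the truncated logarithm inside the unit ball. -/
noncomputable def innerGrad (N : ℕ) : RN N → EuclideanSpace ℝ (Fin N → Fin N) :=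
  (Metric.closedBall (0 : RN N) 1).indicator (gradTensor N (truncLog N))

lemma integrable_innerGrad : Integrable (innerGrad N) volume := by
  rw [innerGrad, integrable_indicator_iff measurableSet_closedBall]
  exact (continuous_gradTensor contDiff_truncLog).continuousOn.integrableOn_compact
    (isCompact_closedBall _ _)

/-- Beyond radius M the two logarithmic gradients cancel by homogeneity. What remains is the pure
logarithm on the annulus plus an error made of one fixed field on the unit ball and its rescaling.
-/
lemma gradTensor_logCutoff (hN : 1 ≤ N) {M : ℝ} (hM : 1 < M) (x : RN N) :
    gradTensor N (logCutoff N M) x = -(Real.log M)⁻¹ •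
      ((innerGrad N x - (M⁻¹) ^ N • innerGrad N (M⁻¹ • x)) +
        (annulus N M).indicator (gradTensor N (logNorm N)) x) := by
  have hM0 : 0 < M := by linarith
  have h1 : gradTensor N (logCutoff N M) x = -(Real.log M)⁻¹ •
      (gradTensor N (truncLog N) x - (M⁻¹) ^ N • gradTensor N (truncLog N) (M⁻¹ • x)) := by
    ext i
    have e1 : partialDeriv i (logCutoff N M) x = partialDeriv i (fun _ => (1 : ℝ)) x +
        partialDeriv i (fun x => -(Real.log M)⁻¹ *
          (truncLog N x + -1 * truncLog N (M⁻¹ • x))) x :=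
      partialDeriv_add contDiffAt_const (contDiff_const.mul (contDiff_truncLog.add
        (contDiff_const.mul (contDiff_truncLog_smul _)))).contDiffAt i
    rw [gradTensor_apply, e1, partialDeriv_const (by omega),
      partialDeriv_const_mul (contDiff_truncLog.add
        (contDiff_const.mul (contDiff_truncLog_smul _))).contDiffAt,
      partialDeriv_add contDiff_truncLog.contDiffAt
        (contDiff_const.mul (contDiff_truncLog_smul _)).contDiffAt,
      partialDeriv_const_mul (contDiff_truncLog_smul _).contDiffAt,
      partialDeriv_comp_smul (by positivity)]
    simp only [PiLp.smul_apply, PiLp.sub_apply, gradTensor_apply, smul_eq_mul]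
    ring
  rw [h1]
  congr 1
  have hnorm : ‖M⁻¹ • x‖ = ‖x‖ / M := by
    rw [norm_smul, norm_inv, Real.norm_of_nonneg hM0.le, inv_mul_eq_div]
  rcases le_or_gt ‖x‖ 1 with hx | hx
  · have h2 : ‖M⁻¹ • x‖ ≤ 1 := by rw [hnorm, div_le_iff₀ hM0]; linarith
    rw [innerGrad, Set.indicator_of_mem (mem_closedBall_zero_iff.2 hx),
      Set.indicator_of_mem (mem_closedBall_zero_iff.2 h2),
      Set.indicator_of_notMem (by simp [annulus, hx]), add_zero]
  · rw [gradTensor_truncLog hx]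
    have h3 : innerGrad N x = 0 := Set.indicator_of_notMem (by simpa using hx) _
    rcases le_or_gt ‖x‖ M with hxM | hxM
    · have h2 : ‖M⁻¹ • x‖ ≤ 1 := by rw [hnorm, div_le_iff₀ hM0]; linarith
      rw [h3, innerGrad, Set.indicator_of_mem (mem_closedBall_zero_iff.2 h2),
        Set.indicator_of_mem (show x ∈ annulus N M from ⟨hx, hxM⟩)]
      abel
    · have h2 : 1 < ‖M⁻¹ • x‖ := by rw [hnorm, lt_div_iff₀ hM0]; linarith
      have h4 : innerGrad N (M⁻¹ • x) = 0 := Set.indicator_of_notMem (by simpa using h2) _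
      have hx0 : x ≠ 0 := norm_pos_iff.1 (by linarith)
      rw [h3, h4, Set.indicator_of_notMem (by simp [annulus, hxM]), gradTensor_truncLog h2]
      have h5 : gradTensor N (logNorm N) (M⁻¹ • x) =
          ((M⁻¹) ^ N)⁻¹ • gradTensor N (logNorm N) x := by
        ext i
        simpa using partialDeriv_logNorm_smul (by omega) (inv_pos.2 hM0) hx0 i
      rw [h5, smul_smul, mul_inv_cancel₀ (by positivity)]
      simp

/-- The rescaling preserves the L¹ norm, so the error is bounded independently of M and disappears
after division by log M. -/
lemma integral_norm_innerGrad_sub_le (M : ℝ) (hM : 0 < M) :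
    Integrable (fun x => innerGrad N x - (M⁻¹) ^ N • innerGrad N (M⁻¹ • x)) volume ∧
    ∫ x, ‖innerGrad N x - (M⁻¹) ^ N • innerGrad N (M⁻¹ • x)‖ ≤ 2 * ∫ x, ‖innerGrad N x‖ := by
  have hi := integrable_innerGrad (N := N)
  have hi2 : Integrable (fun x => (M⁻¹) ^ N • innerGrad N (M⁻¹ • x)) volume :=
    (hi.comp_smul (inv_pos.2 hM).ne').smul ((M⁻¹) ^ N)
  refine ⟨hi.sub hi2, ?_⟩
  have h := Measure.integral_comp_smul (volume : Measure (RN N)) (fun x => ‖innerGrad N x‖) M⁻¹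
  have h2 : ∫ x, ‖(M⁻¹) ^ N • innerGrad N (M⁻¹ • x)‖ = ∫ x, ‖innerGrad N x‖ := by
    simp_rw [norm_smul]
    rw [integral_const_mul, h, finrank_euclideanSpace, Fintype.card_fin, smul_eq_mul, ← mul_assoc,
      abs_of_pos (by positivity), Real.norm_of_nonneg (by positivity),
      mul_inv_cancel₀ (by positivity), one_mul]
  calc ∫ x, ‖innerGrad N x - (M⁻¹) ^ N • innerGrad N (M⁻¹ • x)‖
      ≤ ∫ x, (‖innerGrad N x‖ + ‖(M⁻¹) ^ N • innerGrad N (M⁻¹ • x)‖) :=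
        integral_mono (hi.sub hi2).norm (hi.norm.add hi2.norm) fun x => norm_sub_le _ _
    _ = 2 * ∫ x, ‖innerGrad N x‖ := by
        rw [integral_add hi.norm hi2.norm, h2]; ring

variable {s : ℝ} (hN : 1 ≤ N)
  (hs : ∀ x : RN N, x ≠ 0 → ‖gradTensor N (logNorm N) x‖ = s / ‖x‖ ^ N)

include hs in
lemma norm_gradTensor_logNorm_annulus {M : ℝ} {x : RN N} (hx : x ∈ annulus N M) :
    ‖gradTensor N (logNorm N) x‖ = s * (‖x‖ ^ N)⁻¹ := by
  rw [hs x (norm_pos_iff.1 (by linarith [hx.1])), div_eq_mul_inv]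

include hN hs in
-- The annulus contributes s ω log M before division by log M, hence exactly s ω; the rest is
-- O(1/log M).
lemma integral_norm_gradTensor_logCutoff_le {M : ℝ} (hM : 1 < M) :
    ∫ x, ‖gradTensor N (logCutoff N M) x‖ ≤
      s * sphereArea N + 2 * (∫ x, ‖innerGrad N x‖) * (Real.log M)⁻¹ := by
  have hlog := Real.log_pos hM
  obtain ⟨hi, hle⟩ := integral_norm_innerGrad_sub_le (N := N) M (by linarith)
  have hA : ∫ x, (annulus N M).indicator (fun x => s * (‖x‖ ^ N)⁻¹) x =
      s * (sphereArea N * Real.log M) := by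
    rw [integral_indicator (measurableSet_annulus M), integral_const_mul,
      integral_annulus hN hM.le]
  have hAi : Integrable ((annulus N M).indicator (fun x => s * (‖x‖ ^ N)⁻¹)) volume :=
    (integrable_indicator_iff (measurableSet_annulus M)).2
      ((integrableOn_annulus hN M).const_mul s)
  calc ∫ x, ‖gradTensor N (logCutoff N M) x‖
      ≤ ∫ x, (Real.log M)⁻¹ * (‖innerGrad N x - (M⁻¹) ^ N • innerGrad N (M⁻¹ • x)‖ +
          (annulus N M).indicator (fun x => s * (‖x‖ ^ N)⁻¹) x) := by
        refine integral_mono (integrable_gradTensor (contDiff_logCutoff M)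
          (hasCompactSupport_logCutoff hM)).norm ((hi.norm.add hAi).const_mul _) fun x => ?_
        simp only [gradTensor_logCutoff hN hM]
        rw [norm_smul, norm_neg, Real.norm_of_nonneg (by positivity)]
        gcongr
        refine (norm_add_le _ _).trans ?_
        gcongr
        by_cases hx : x ∈ annulus N M
        · simp only [Set.indicator_of_mem hx, norm_gradTensor_logNorm_annulus hs hx, le_refl]
        · simp [Set.indicator_of_notMem hx]
    _ ≤ (Real.log M)⁻¹ * (2 * (∫ x, ‖innerGrad N x‖) + s * (sphereArea N * Real.log M)) := by
        rw [integral_const_mul, integral_add hi.norm hAi, hA]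
        gcongr
    _ = _ := by field_simp; ring

include hN hs in
-- On the annulus the pairing of ∇^N log with the kernel is s²|x|^(-N). Testing the representation
-- on a logarithmic cutoff, whose value at 0 is 1, gives c = -s²ω + O(1/log M).
lemma kernel_constant_eq (hs0 : 0 ≤ s) {c : ℝ} (hc : ∀ u : RN N → ℝ, ContDiff ℝ ∞ u →
    HasCompactSupport u → ∫ x, inner ℝ (gradTensor N u x) (kernel N x) = c * u 0) :
    c = -(s ^ 2 * sphereArea N) := by
  set Q := ∫ x, ‖innerGrad N x‖
  have hbound : ∀ M : ℝ, 1 < M → |c + s ^ 2 * sphereArea N| ≤ 2 * Q * s * (Real.log M)⁻¹ := by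
    intro M hM
    have hlog := Real.log_pos hM
    obtain ⟨hi, hle⟩ := integral_norm_innerGrad_sub_le (N := N) M (by linarith)
    set R : RN N → EuclideanSpace ℝ (Fin N → Fin N) :=
      fun x => innerGrad N x - (M⁻¹) ^ N • innerGrad N (M⁻¹ • x)
    have h := hc _ (contDiff_logCutoff M) (hasCompactSupport_logCutoff hM)
    rw [(logCutoff_eventually_eq_one hM).self_of_nhds, mul_one] at h
    have hRb : ∀ x, ‖inner ℝ (R x) (kernel N x)‖ ≤ ‖R x‖ * s := fun x =>
      (norm_inner_le_norm _ _).trans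
        (mul_le_mul_of_nonneg_left (norm_kernel_le hN hs0 hs x) (norm_nonneg _))
    have hRi : Integrable (fun x => inner ℝ (R x) (kernel N x)) volume :=
      (hi.norm.mul_const s).mono' (hi.aestronglyMeasurable.inner
        measurable_kernel.aestronglyMeasurable) (.of_forall hRb)
    have hAi : Integrable ((annulus N M).indicator (fun x => s ^ 2 * (‖x‖ ^ N)⁻¹)) volume :=
      (integrable_indicator_iff (measurableSet_annulus M)).2
        ((integrableOn_annulus hN M).const_mul _)
    have hpt : ∀ x, inner ℝ (gradTensor N (logCutoff N M) x) (kernel N x) =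
        -(Real.log M)⁻¹ * (inner ℝ (R x) (kernel N x) +
          (annulus N M).indicator (fun x => s ^ 2 * (‖x‖ ^ N)⁻¹) x) := fun x => by
      rw [gradTensor_logCutoff hN hM, real_inner_smul_left, inner_add_left]
      congr 2
      by_cases hx : x ∈ annulus N M
      · have hx1 : 0 < ‖x‖ := by linarith [hx.1]
        rw [Set.indicator_of_mem hx, Set.indicator_of_mem hx, kernel, real_inner_smul_right,
          real_inner_self_eq_norm_sq, norm_gradTensor_logNorm_annulus hs hx]
        field_simp
      · simp [Set.indicator_of_notMem hx]
    simp_rw [hpt] at h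
    rw [integral_const_mul, integral_add hRi hAi, integral_indicator (measurableSet_annulus M),
      integral_const_mul, integral_annulus hN hM.le] at h
    have hRle : |∫ x, inner ℝ (R x) (kernel N x)| ≤ 2 * Q * s := by
      rw [← Real.norm_eq_abs]
      refine (norm_integral_le_of_norm_le (hi.norm.mul_const s) (.of_forall hRb)).trans ?_
      rw [integral_mul_const]
      gcongr
    have : c + s ^ 2 * sphereArea N = -(∫ x, inner ℝ (R x) (kernel N x)) * (Real.log M)⁻¹ := by
      rw [← h]; field_simp; ring
    rw [this, abs_mul, abs_neg, abs_of_pos (inv_pos.2 hlog)]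
    gcongr
  have hlim : Filter.Tendsto (fun M => 2 * Q * s * (Real.log M)⁻¹) Filter.atTop (nhds 0) := by
    simpa using (Real.tendsto_log_atTop.inv_tendsto_atTop).const_mul (2 * Q * s)
  have h0 : |c + s ^ 2 * sphereArea N| ≤ 0 := ge_of_tendsto hlim
    ((Filter.eventually_gt_atTop 1).mono hbound)
  linarith [abs_nonpos_iff.1 h0]

lemma one_le_eLpNorm_top {u : RN N → ℝ} (h : ∀ᶠ x in nhds (0 : RN N), u x = 1) :
    1 ≤ eLpNorm u ∞ volume := by
  rw [eLpNorm_exponent_top]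
  have hpos : volume {x : RN N | u x = 1} ≠ 0 := (Measure.measure_pos_of_mem_nhds volume h).ne'
  obtain ⟨x, hx, hx'⟩ := Measure.exists_mem_of_measure_ne_zero_of_ae hpos
    (ae_restrict_of_ae (ae_le_eLpNormEssSup (f := u) (μ := volume)))
  have hx1 : u x = 1 := hx
  simpa [hx1] using hx'

include hN hs in
-- Logarithmic cutoffs have supremum at least 1 and energy at most s ω + O(1/log M).
lemma SmoothAdmissible.le (hs0 : 0 < s) {C : ℝ} (hC : SmoothAdmissible N C) :
    (s * sphereArea N)⁻¹ ≤ C := by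
  have hω := sphereArea_pos hN
  set Q := ∫ x, ‖innerGrad N x‖
  have h1 : ∀ M : ℝ, 1 < M → 1 ≤ C * (s * sphereArea N + 2 * Q * (Real.log M)⁻¹) := by
    intro M hM
    have h := (one_le_eLpNorm_top (logCutoff_eventually_eq_one (N := N) hM)).trans
      (hC _ (contDiff_logCutoff M) (hasCompactSupport_logCutoff hM))
    rw [ENNReal.one_le_ofReal] at h
    simp_rw [gradNorm_eq_norm] at h
    have hI : 0 ≤ ∫ x, ‖gradTensor N (logCutoff N M) x‖ := integral_nonneg fun _ => norm_nonneg _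
    -- A negative C would make the right side nonpositive; the sign is needed to insert the upper
    -- bound for the energy.
    have hCpos : 0 ≤ C := by
      by_contra hneg
      nlinarith
    exact h.trans (mul_le_mul_of_nonneg_left
      (integral_norm_gradTensor_logCutoff_le hN hs hM) hCpos)
  have hlim : Filter.Tendsto (fun M => C * (s * sphereArea N + 2 * Q * (Real.log M)⁻¹))
      Filter.atTop (nhds (C * (s * sphereArea N + 2 * Q * 0))) :=
    (((Real.tendsto_log_atTop.inv_tendsto_atTop).const_mul _).const_add _).const_mul _
  have h2 : 1 ≤ C * (s * sphereArea N + 2 * Q * 0) :=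
    ge_of_tendsto hlim ((Filter.eventually_gt_atTop 1).mono h1)
  rw [inv_le_iff_one_le_mul₀ (by positivity)]
  simpa using h2

end

/-! ### Derivatives of convolutions with a locally integrable function. -/

section convolution

open scoped Convolution

variable {E : Type*} [NormedAddCommGroup E] [NormedSpace ℝ E] [FiniteDimensional ℝ E]
  [MeasurableSpace E] [BorelSpace E] {μ : Measure E} [μ.IsAddHaarMeasure]

/-- All derivatives fall on the smooth compactly supported factor, so no regularity of `K` is
needed. -/
lemma iteratedFDeriv_convolution_apply {K f : E → ℝ} (hK : LocallyIntegrable K μ)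
    (hf : ContDiff ℝ ∞ f) (hs : HasCompactSupport f) (k : ℕ) (y : E) (v : Fin k → E) :
    iteratedFDeriv ℝ k (fun y => ∫ z, K z * f (y - z) ∂μ) y v =
      ∫ z, K z * iteratedFDeriv ℝ k f (y - z) v ∂μ := by
  have hconv : (fun y => ∫ z, K z * f (y - z) ∂μ) = K ⋆[ContinuousLinearMap.mul ℝ ℝ, μ] f := rfl
  have hsm : ContDiff ℝ ∞ (K ⋆[ContinuousLinearMap.mul ℝ ℝ, μ] f) :=
    hs.contDiff_convolution_right _ hK hf
  induction k generalizing y with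
  | zero => simp
  | succ k ih =>
    have hd : DifferentiableAt ℝ (iteratedFDeriv ℝ k (fun y => ∫ z, K z * f (y - z) ∂μ)) y := by
      rw [hconv]
      exact hsm.differentiable_iteratedFDeriv (by exact_mod_cast WithTop.coe_lt_top k) y
    have hdf : ∀ x, DifferentiableAt ℝ (iteratedFDeriv ℝ k f) x :=
      hf.differentiable_iteratedFDeriv (by exact_mod_cast WithTop.coe_lt_top k)
    have happ : ∀ {w : E → ContinuousMultilinearMap ℝ (fun _ : Fin k => E) ℝ} {x : E},
        DifferentiableAt ℝ w x → ∀ a : E, fderiv ℝ (fun z => w z (Fin.tail v)) x a =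
          fderiv ℝ w x a (Fin.tail v) := fun {w x} hw a =>
      congrArg (fun B => B a) (((ContinuousMultilinearMap.apply ℝ (fun _ : Fin k => E) ℝ
        (Fin.tail v)).hasFDerivAt.comp x hw.hasFDerivAt).fderiv)
    let g : E → ℝ := fun x => iteratedFDeriv ℝ k f x (Fin.tail v)
    have hg : ContDiff ℝ ∞ g :=
      (ContinuousMultilinearMap.apply ℝ (fun _ : Fin k => E) ℝ (Fin.tail v)).contDiff.comp
        (hf.iteratedFDeriv_right (by norm_cast))
    have hgs : HasCompactSupport g := (hs.iteratedFDeriv (𝕜 := ℝ) k).comp_left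
      (g := fun A : ContinuousMultilinearMap ℝ (fun _ : Fin k => E) ℝ => A (Fin.tail v)) rfl
    have h1 := (hgs.hasFDerivAt_convolution_right (ContinuousLinearMap.mul ℝ ℝ) (μ := μ) hK
      (hg.of_le (by norm_cast)) y).fderiv
    have hcg : Continuous (fderiv ℝ g) := hg.continuous_fderiv (by norm_num)
    rw [iteratedFDeriv_succ_apply_left, ← happ hd]
    simp_rw [ih]
    have h2 := congrArg (fun B => B (v 0)) h1
    rw [convolution_precompR_apply _ hK (hgs.fderiv (𝕜 := ℝ)) hcg] at h2
    refine h2.trans (integral_congr_ae (.of_forall fun z => ?_))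
    simp only [ContinuousLinearMap.mul_apply', iteratedFDeriv_succ_apply_left]
    rw [← happ (hdf _)]

lemma exists_bound_iteratedFDeriv_convolution {K f : E → ℝ} {s : ℝ} (hK : LocallyIntegrable K μ)
    (hKs : ∀ x, |K x| ≤ s) (hf : ContDiff ℝ ∞ f) (hs : HasCompactSupport f) (k : ℕ) :
    ∃ C, ∀ y, ‖iteratedFDeriv ℝ k (fun y => ∫ z, K z * f (y - z) ∂μ) y‖ ≤ C := by
  have hs0 : 0 ≤ s := (abs_nonneg _).trans (hKs 0)
  have hi : Integrable (iteratedFDeriv ℝ k f) μ :=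
    (hf.continuous_iteratedFDeriv (by exact_mod_cast le_top)).integrable_of_hasCompactSupport
      (hs.iteratedFDeriv k)
  refine ⟨s * ∫ z, ‖iteratedFDeriv ℝ k f z‖ ∂μ, fun y => ?_⟩
  refine ContinuousMultilinearMap.opNorm_le_bound (by positivity) fun v => ?_
  rw [iteratedFDeriv_convolution_apply hK hf hs]
  have hi' : Integrable (fun z => s * (‖iteratedFDeriv ℝ k f (y - z)‖ * ∏ j, ‖v j‖)) μ :=
    ((hi.comp_sub_left y).norm.mul_const _).const_mul s
  refine (norm_integral_le_of_norm_le hi' (.of_forall fun z => ?_)).trans_eq ?_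
  · rw [norm_mul]
    exact mul_le_mul (hKs z) (ContinuousMultilinearMap.le_opNorm _ _) (norm_nonneg _) hs0
  · rw [integral_const_mul, integral_mul_const,
      integral_sub_left_eq_self (fun z => ‖iteratedFDeriv ℝ k f z‖) μ y, mul_assoc]

end convolution

/-! ### Representation of Sobolev functions by potentials. -/

/-- The tensor of weak derivatives of order `m`. -/
noncomputable def weakGradTensor {N : ℕ} (m : ℕ) (u : RN N → ℝ) (x : RN N) :
    EuclideanSpace ℝ (Fin m → Fin N) :=
  WithLp.toLp 2 (fun i => weakPartial i u x)

/-- The representation of a function by its derivatives of order `N`, up to a constant. -/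
noncomputable def potential {N : ℕ} (G : RN N → EuclideanSpace ℝ (Fin N → Fin N)) (x : RN N) : ℝ :=
  ∫ y, inner ℝ (G y) (kernel N (y - x))

section

variable {N m : ℕ}

lemma weakGradNorm_eq_norm (u : RN N → ℝ) (x : RN N) :
    weakGradNorm m u x = ‖weakGradTensor m u x‖ := by
  simp [weakGradNorm, EuclideanSpace.norm_eq, weakGradTensor]

lemma MemW.integrable_weakGradTensor {u : RN N → ℝ} (hu : MemW m u) :
    Integrable (weakGradTensor m u) volume :=
  Integrable.of_eval_piLp fun i => (hu.hasWeakPartial i).2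

variable {s : ℝ} {G : RN N → EuclideanSpace ℝ (Fin N → Fin N)}

lemma abs_inner_kernel_le (hs : ∀ x, ‖kernel N x‖ ≤ s) (x y : RN N) :
    ‖inner ℝ (G y) (kernel N (y - x))‖ ≤ ‖G y‖ * s :=
  (norm_inner_le_norm _ _).trans (mul_le_mul_of_nonneg_left (hs _) (norm_nonneg _))

lemma aestronglyMeasurable_inner_kernel (hG : Integrable G volume) (x : RN N) :
    AEStronglyMeasurable (fun y => inner ℝ (G y) (kernel N (y - x))) volume :=
  hG.aestronglyMeasurable.inner
    (measurable_kernel.comp (measurable_id.sub_const x)).aestronglyMeasurable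

lemma integrable_inner_kernel (hs : ∀ x, ‖kernel N x‖ ≤ s) (hG : Integrable G volume) (x : RN N) :
    Integrable (fun y => inner ℝ (G y) (kernel N (y - x))) volume :=
  (hG.norm.mul_const s).mono' (aestronglyMeasurable_inner_kernel hG x)
    (.of_forall (abs_inner_kernel_le hs x))

lemma abs_potential_le (hs : ∀ x, ‖kernel N x‖ ≤ s) (hG : Integrable G volume) (x : RN N) :
    |potential G x| ≤ s * ∫ y, ‖G y‖ := by
  rw [mul_comm, ← integral_mul_const, ← Real.norm_eq_abs]
  exact norm_integral_le_of_norm_le (hG.norm.mul_const s) (.of_forall (abs_inner_kernel_le hs x))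

lemma nontrivial_RN (hN : 1 ≤ N) : Nontrivial (RN N) := by
  have : Nonempty (Fin N) := ⟨⟨0, hN⟩⟩
  infer_instance

lemma ae_ne_point (hN : 1 ≤ N) (x : RN N) : ∀ᵐ y, y ≠ x := by
  have := nontrivial_RN hN
  exact compl_mem_ae_iff.2 (measure_singleton x)

/-- The kernel is bounded and discontinuous at most at the origin, a null set, so dominated
convergence applies. -/
lemma continuous_potential (hN : 1 ≤ N) (hs : ∀ x, ‖kernel N x‖ ≤ s) (hG : Integrable G volume) :
    Continuous (potential G) := by
  refine continuous_iff_continuousAt.2 fun x => ?_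
  refine continuousAt_of_dominated (bound := fun y => ‖G y‖ * s)
    (.of_forall fun x => aestronglyMeasurable_inner_kernel hG x)
    (.of_forall fun x => .of_forall (abs_inner_kernel_le hs x)) (hG.norm.mul_const s) ?_
  filter_upwards [ae_ne_point hN x] with y hy
  have h : ContinuousAt (fun x => kernel N (y - x)) x :=
    ContinuousAt.comp (f := fun x => y - x) (continuousAt_kernel (sub_ne_zero.2 hy))
      (continuousAt_const.sub continuousAt_id)
  exact continuousAt_const.inner h

lemma locallyIntegrable_kernel_apply (hs : ∀ x, ‖kernel N x‖ ≤ s) (i : Fin N → Fin N) :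
    LocallyIntegrable (fun x => kernel N x i) volume := by
  refine (locallyIntegrable_const s).mono ?_ (.of_forall fun x => ?_)
  · exact ((EuclideanSpace.proj i : _ →L[ℝ] ℝ).continuous.measurable.comp
      measurable_kernel).aestronglyMeasurable
  · exact (PiLp.norm_apply_le _ i).trans ((hs x).trans (le_abs_self s))

/-- Fubini moves the kernel onto φ. The resulting convolutions lack compact support but have bounded
derivatives, so the weak derivatives of u may still be tested against them. -/
lemma integral_potential_mul {c : ℝ} (hs : ∀ x, ‖kernel N x‖ ≤ s)
    (hc : ∀ u : RN N → ℝ, ContDiff ℝ ∞ u →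
      HasCompactSupport u → ∫ x, inner ℝ (gradTensor N u x) (kernel N x) = c * u 0)
    {u : RN N → ℝ} (hu : MemW N u) {φ : RN N → ℝ} (hφ : ContDiff ℝ ∞ φ)
    (hφs : HasCompactSupport φ) :
    ∫ x, potential (weakGradTensor N u) x * φ x = c * ∫ x, u x * φ x := by
  have hG := hu.integrable_weakGradTensor
  have hK := locallyIntegrable_kernel_apply (N := N) hs
  have hKs : ∀ i x, |kernel N x i| ≤ s := fun i x => (PiLp.norm_apply_le _ i).trans (hs x)
  let Ψ : (Fin N → Fin N) → RN N → ℝ := fun i y => ∫ z, kernel N z i * φ (y - z)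
  have hΨ : ∀ i, ContDiff ℝ ∞ (Ψ i) := fun i =>
    hφs.contDiff_convolution_right (ContinuousLinearMap.mul ℝ ℝ) (hK i) hφ
  have hΨb : ∀ i k, ∃ C, ∀ y, ‖iteratedFDeriv ℝ k (Ψ i) y‖ ≤ C := fun i k =>
    exists_bound_iteratedFDeriv_convolution (hK i) (hKs i) hφ hφs k
  have hΨ' : ∀ i y, partialDeriv i (Ψ i) y = ∫ z, kernel N z i * partialDeriv i φ (y - z) :=
    fun i y => iteratedFDeriv_convolution_apply (hK i) hφ hφs N y _
  have hint : ∀ i y, Integrable (fun z => kernel N z i * partialDeriv i φ (y - z)) volume :=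
    fun i y => ((hφs.partialDeriv i).convolutionExists_right (ContinuousLinearMap.mul ℝ ℝ)
      (hK i) (hφ.partialDeriv i).continuous y)
  have hint0 : ∀ i y, Integrable (fun z => kernel N z i * φ (y - z)) volume :=
    fun i y => (hφs.convolutionExists_right (ContinuousLinearMap.mul ℝ ℝ)
      (hK i) hφ.continuous y)
  -- This is the representation formula for z ↦ φ(y - z); the reflection accounts for the sign
  -- (-1)^N.
  have hsum : ∀ y, ∑ i, partialDeriv i (Ψ i) y = (-1) ^ N * (c * φ y) := by
    intro y
    have h := hc (fun z => φ (y - z)) (hφ.comp (contDiff_const.sub contDiff_id))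
      (hφs.comp_homeomorph (Homeomorph.subLeft y))
    simp_rw [hΨ']
    rw [← integral_finsetSum _ fun i _ => hint i y]
    simp only [inner_gradTensor, partialDeriv_comp_sub_left, sub_zero] at h
    rw [← h, ← integral_const_mul]
    refine integral_congr_ae (.of_forall fun z => ?_)
    simp only [Finset.mul_sum]
    refine Finset.sum_congr rfl fun i _ => ?_
    have : ((-1 : ℝ) ^ N) * (-1) ^ N = 1 := by rw [← mul_pow]; simp
    linear_combination (-(kernel N z i * partialDeriv i φ (y - z))) * this
  have hweak : ∀ i, ∫ y, u y * partialDeriv i (Ψ i) y =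
      (-1) ^ N * ∫ y, weakPartial i u y * Ψ i y := fun i =>
    (hu.hasWeakPartial i).1.integral_eq_of_bounded hu.1 (hu.hasWeakPartial i).2 (hΨ i) (hΨb i)
  have hbd0 : ∀ i, ∃ C, ∀ y, ‖Ψ i y‖ ≤ C := fun i => by
    obtain ⟨C, hC⟩ := hΨb i 0
    exact ⟨C, fun y => by simpa using hC y⟩
  have hbdN : ∀ i, ∃ C, ∀ y, ‖partialDeriv i (Ψ i) y‖ ≤ C := fun i => by
    obtain ⟨C, hC⟩ := hΨb i N
    exact ⟨C, fun y => (abs_partialDeriv_le _ _ _).trans (hC y)⟩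
  have h1 : ∫ y, u y * ∑ i, partialDeriv i (Ψ i) y =
      (-1) ^ N * ∫ y, ∑ i, weakPartial i u y * Ψ i y := by
    simp_rw [Finset.mul_sum]
    rw [integral_finsetSum, integral_finsetSum, Finset.mul_sum]
    · exact Finset.sum_congr rfl fun i _ => hweak i
    · intro i _
      obtain ⟨C, hC⟩ := hbd0 i
      exact (hu.hasWeakPartial i).2.mul_bdd (hΨ i).continuous.aestronglyMeasurable (.of_forall hC)
    · intro i _
      obtain ⟨C, hC⟩ := hbdN i
      exact hu.1.mul_bdd ((hΨ i).partialDeriv i).continuous.aestronglyMeasurable (.of_forall hC)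
  have h2 : c * ∫ x, u x * φ x = ∫ y, ∑ i, weakPartial i u y * Ψ i y := by
    have h3 : ∫ y, u y * ∑ i, partialDeriv i (Ψ i) y = (-1) ^ N * (c * ∫ x, u x * φ x) := by
      rw [← integral_const_mul, ← integral_const_mul]
      refine integral_congr_ae (.of_forall fun y => ?_)
      simp only [hsum]; ring
    exact mul_left_cancel₀ (pow_ne_zero N (by norm_num : (-1 : ℝ) ≠ 0)) (h3.symm.trans h1)
  rw [h2]
  have hprod : Integrable (Function.uncurry fun x y : RN N =>
      inner ℝ (weakGradTensor N u y) (kernel N (y - x)) * φ x) (volume.prod volume) := by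
    have hφi : Integrable φ volume := hφ.continuous.integrable_of_hasCompactSupport hφs
    have hdom : Integrable (fun p : RN N × RN N => ‖φ p.1‖ * (‖weakGradTensor N u p.2‖ * s))
        (volume.prod volume) := hφi.norm.mul_prod (hG.norm.mul_const s)
    refine hdom.mono' ?_ (.of_forall fun p => ?_)
    · refine AEStronglyMeasurable.mul (AEStronglyMeasurable.inner hG.aestronglyMeasurable.comp_snd
        ?_) hφ.continuous.aestronglyMeasurable.comp_fst
      exact (measurable_kernel.comp (measurable_snd.sub measurable_fst)).aestronglyMeasurable
    · simp only [Function.uncurry]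
      rw [norm_mul, mul_comm]
      gcongr
      exact abs_inner_kernel_le hs _ _
  calc ∫ x, potential (weakGradTensor N u) x * φ x
      = ∫ x, ∫ y, inner ℝ (weakGradTensor N u y) (kernel N (y - x)) * φ x := by
        simp_rw [potential, ← integral_mul_const]
    _ = ∫ y, ∫ x, inner ℝ (weakGradTensor N u y) (kernel N (y - x)) * φ x :=
        integral_integral_swap hprod
    _ = ∫ y, ∑ i, weakPartial i u y * Ψ i y := by
        refine integral_congr_ae (.of_forall fun y => ?_)
        simp only
        -- The substitution z = y - x turns the inner integral into a combination of the Ψ i.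
        rw [← integral_sub_left_eq_self _ volume y]
        simp only [sub_sub_cancel, PiLp.inner_apply, RCLike.inner_apply, conj_trivial,
          Finset.sum_mul, Ψ, ← integral_const_mul]
        rw [integral_finsetSum]
        · refine Finset.sum_congr rfl fun i _ => ?_
          refine integral_congr_ae (.of_forall fun z => ?_)
          simp only [weakGradTensor]
          ring
        · intro i _
          refine ((hint0 i y).const_mul (weakPartial i u y)).congr (.of_forall fun z => ?_)
          simp only [weakGradTensor]
          ring

lemma potential_ae_eq (hN : 1 ≤ N) {c : ℝ} (hs : ∀ x, ‖kernel N x‖ ≤ s)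
    (hc : ∀ u : RN N → ℝ, ContDiff ℝ ∞ u →
      HasCompactSupport u → ∫ x, inner ℝ (gradTensor N u x) (kernel N x) = c * u 0)
    {u : RN N → ℝ} (hu : MemW N u) :
    potential (weakGradTensor N u) =ᵐ[volume] fun x => c * u x := by
  refine ae_eq_of_integral_contDiff_smul_eq
    (continuous_potential hN hs hu.integrable_weakGradTensor).locallyIntegrable
    (hu.1.const_mul c).locallyIntegrable fun φ hφ hφs => ?_
  have h := integral_potential_mul hs hc hu hφ hφs
  simp only [smul_eq_mul, mul_comm (φ _)]
  rw [h, ← integral_const_mul]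
  simp only [mul_assoc]

/-- Test against the constant function 1, whose derivatives of positive order vanish. -/
lemma integral_weakGradTensor (hm : m ≠ 0) {u : RN N → ℝ} (hu : MemW m u) :
    ∫ x, weakGradTensor m u x = 0 := by
  ext i
  have h1 : (∫ x, weakGradTensor m u x) i = ∫ x, weakPartial i u x :=
    ((EuclideanSpace.proj i : EuclideanSpace ℝ (Fin m → Fin N) →L[ℝ] ℝ).integral_comp_comm
      hu.integrable_weakGradTensor).symm
  have h2 := (hu.hasWeakPartial i).1.integral_eq_of_bounded hu.1 (hu.hasWeakPartial i).2
    (Ψ := fun _ => 1) contDiff_const fun k => by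
      rcases eq_or_ne k 0 with rfl | hk
      · exact ⟨1, fun x => by simp⟩
      · exact ⟨0, fun x => by simp [iteratedFDeriv_const_of_ne hk]⟩
  simp only [partialDeriv_const hm, mul_zero, integral_zero, mul_one] at h2
  rw [h1]
  simpa using h2.symm

/-- After scaling by 1/‖x‖, which leaves the kernel unchanged, the two points lie near the unit
sphere at distance ‖y‖/‖x‖; uniform continuity on a compact shell concludes. -/
lemma tendsto_kernel_sub_kernel (hN : 1 ≤ N) (y : RN N) :
    Filter.Tendsto (fun x => kernel N (y - x) - kernel N (-x)) (Filter.cocompact (RN N))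
      (nhds 0) := by
  let S : Set (RN N) := {z | 1 / 2 ≤ ‖z‖ ∧ ‖z‖ ≤ 2}
  have hS : IsCompact S := by
    refine (isCompact_closedBall (0 : RN N) 2).of_isClosed_subset ?_ fun z hz => by simpa using hz.2
    exact (isClosed_le continuous_const continuous_norm).inter
      (isClosed_le continuous_norm continuous_const)
  have huc := hS.uniformContinuousOn_of_continuous (f := kernel N) fun z hz =>
    (continuousAt_kernel (norm_pos_iff.1 (by linarith [hz.1]))).continuousWithinAt
  rw [Metric.tendsto_nhds]
  intro ε hε
  obtain ⟨δ, hδ, hδ'⟩ := Metric.uniformContinuousOn_iff.1 huc ε hε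
  filter_upwards [(tendsto_norm_cocompact_atTop (E := RN N)).eventually_gt_atTop
    -- The bound 2‖y‖ keeps the rescaled points in the shell; ‖y‖/δ makes them δ-close.
    (max 0 (max (2 * ‖y‖) (‖y‖ / δ)))] with x hx
  rw [max_lt_iff, max_lt_iff] at hx
  obtain ⟨hx0, hx2, hx3⟩ := hx
  have hinv : 0 < ‖x‖⁻¹ := inv_pos.2 hx0
  rw [← kernel_smul hN hinv (y - x), ← kernel_smul hN hinv (-x), dist_zero_right, ← dist_eq_norm]
  have h2 : ‖‖x‖⁻¹ • (-x)‖ = 1 := by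
    rw [norm_smul, norm_neg, norm_inv, norm_norm, inv_mul_cancel₀ hx0.ne']
  have hdist : dist (‖x‖⁻¹ • (y - x)) (‖x‖⁻¹ • (-x)) = ‖y‖ / ‖x‖ := by
    rw [dist_eq_norm, ← smul_sub, norm_smul, norm_inv, norm_norm, inv_mul_eq_div]
    simp
  have hhalf : ‖y‖ / ‖x‖ ≤ 1 / 2 := by rw [div_le_iff₀ hx0]; linarith
  have h3 := abs_norm_sub_norm_le (‖x‖⁻¹ • (y - x)) (‖x‖⁻¹ • (-x))
  rw [← dist_eq_norm, hdist, h2] at h3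
  have h4 := abs_le.1 (h3.trans hhalf)
  refine hδ' _ ⟨by linarith, by linarith⟩ _ ⟨by rw [h2]; norm_num, by rw [h2]; norm_num⟩ ?_
  rw [hdist, div_lt_iff₀ hx0]
  rw [div_lt_iff₀ hδ] at hx3
  linarith

/-- The kernel itself does not decay, but mean zero allows K(-x) to be subtracted from K(y - x), and
this difference does. -/
lemma tendsto_potential (hN : 1 ≤ N) (hs : ∀ x, ‖kernel N x‖ ≤ s) (hG : Integrable G volume)
    (hG0 : ∫ x, G x = 0) :
    Filter.Tendsto (potential G) (Filter.cocompact (RN N)) (nhds 0) := by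
  have hcg : (Filter.cocompact (RN N)).IsCountablyGenerated := by
    rw [← Metric.cobounded_eq_cocompact, ← comap_norm_atTop]
    infer_instance
  have h1 : potential G = fun x => ∫ y, inner ℝ (G y) (kernel N (y - x) - kernel N (-x)) := by
    ext x
    have h2 : ∫ y, inner ℝ (G y) (kernel N (-x)) = 0 := by
      simp_rw [fun y => real_inner_comm (kernel N (-x)) (G y)]
      rw [integral_inner hG, hG0, inner_zero_right]
    simp_rw [inner_sub_right]
    rw [integral_sub (integrable_inner_kernel hs hG x) (hG.inner_const _), h2, sub_zero]
    rfl
  rw [h1]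
  have h3 : (0 : ℝ) = ∫ y, inner ℝ (G y) (0 : EuclideanSpace ℝ (Fin N → Fin N)) := by simp
  rw [h3]
  refine tendsto_integral_filter_of_dominated_convergence (fun y => ‖G y‖ * (s + s))
    (.of_forall fun x => ?_) (.of_forall fun x => .of_forall fun y => ?_)
    (hG.norm.mul_const _) (.of_forall fun y => ?_)
  · exact hG.aestronglyMeasurable.inner
      ((measurable_kernel.comp (measurable_id.sub_const x)).sub_const _).aestronglyMeasurable
  · refine (norm_inner_le_norm _ _).trans (mul_le_mul_of_nonneg_left ?_ (norm_nonneg _))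
    exact (norm_sub_le _ _).trans (add_le_add (hs _) (hs _))
  · exact tendsto_const_nhds.inner (tendsto_kernel_sub_kernel hN y)

/-- A continuous function vanishing at infinity attains its largest modulus. This supplies the point
at which equality in Cauchy–Schwarz is exploited. -/
lemma exists_abs_potential_max (hN : 1 ≤ N) (hs : ∀ x, ‖kernel N x‖ ≤ s)
    (hG : Integrable G volume) (hG0 : ∫ x, G x = 0) :
    ∃ x₀, ∀ x, |potential G x| ≤ |potential G x₀| := by
  by_cases h : ∃ x₁, potential G x₁ ≠ 0
  · obtain ⟨x₁, hx₁⟩ := h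
    refine (continuous_potential hN hs hG).abs.exists_forall_ge' x₁ ?_
    have := (tendsto_potential hN hs hG hG0).abs
    rw [abs_zero] at this
    exact (this.eventually (gt_mem_nhds (abs_pos.2 hx₁))).mono fun x hx => le_of_lt hx
  · push Not at h
    exact ⟨0, fun x => by simp [h]⟩

end

/-! ### Rigidity: an integrable multiple of the kernel that is an N-th gradient vanishes. -/

section

variable {N m : ℕ}

/-- Weak derivatives of a common function commute with classical differentiation. -/
lemma HasWeakPartial.integral_mul_fderiv_comm {u g g' : RN N → ℝ} {i j : Fin N}
    {I : Fin m → Fin N} (hg : HasWeakPartial (Fin.cons i I : Fin (m + 1) → Fin N) u g)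
    (hg' : HasWeakPartial (Fin.cons j I : Fin (m + 1) → Fin N) u g') {φ : RN N → ℝ}
    (hφ : ContDiff ℝ ∞ φ) (hs : HasCompactSupport φ) :
    ∫ x, g x * fderiv ℝ φ x (EuclideanSpace.single j 1) =
      ∫ x, g' x * fderiv ℝ φ x (EuclideanSpace.single i 1) := by
  have hd : ∀ a : Fin N, ContDiff ℝ ∞ (fun y => fderiv ℝ φ y (EuclideanSpace.single a 1)) :=
    fun a => (hφ.fderiv_right (by norm_cast)).clm_apply contDiff_const
  have hds : ∀ a : Fin N, HasCompactSupport (fun y => fderiv ℝ φ y (EuclideanSpace.single a 1)) :=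
    fun a => (hs.fderiv (𝕜 := ℝ)).comp_left
      (g := fun A : RN N →L[ℝ] ℝ => A (EuclideanSpace.single a 1)) rfl
  have h1 := hg.integral_eq _ (hd j) (hds j)
  have h2 := hg'.integral_eq _ (hd i) (hds i)
  have h3 : ∀ x, partialDeriv (Fin.cons i I : Fin (m + 1) → Fin N)
      (fun y => fderiv ℝ φ y (EuclideanSpace.single j 1)) x =
      partialDeriv (Fin.cons j I : Fin (m + 1) → Fin N)
      (fun y => fderiv ℝ φ y (EuclideanSpace.single i 1)) x := fun x => by
    rw [partialDeriv_fderiv_comm hφ, partialDeriv_fderiv_comm hφ,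
      ← partialDeriv_cons hφ.contDiffAt, ← partialDeriv_cons hφ.contDiffAt,
      partialDeriv_swap hφ.contDiffAt]
  simp_rw [h3] at h1
  exact mul_left_cancel₀ (pow_ne_zero _ (by norm_num : (-1 : ℝ) ≠ 0)) (h1.symm.trans h2)

/-- Test functions supported away from the origin. -/
structure IsTestOff (φ : RN N → ℝ) : Prop where
  contDiff : ContDiff ℝ ∞ φ
  hasCompactSupport : HasCompactSupport φ
  zero_notMem : (0 : RN N) ∉ tsupport φ

namespace IsTestOff

variable {φ f : RN N → ℝ}

lemma eventually_eq_zero (hφ : IsTestOff φ) : φ =ᶠ[nhds 0] 0 :=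
  notMem_tsupport_iff_eventuallyEq.1 hφ.zero_notMem

lemma fderiv_apply (hφ : IsTestOff φ) (v : RN N) : IsTestOff (fun x => fderiv ℝ φ x v) where
  contDiff := (hφ.contDiff.fderiv_right (by norm_cast)).clm_apply contDiff_const
  hasCompactSupport := (hφ.hasCompactSupport.fderiv (𝕜 := ℝ)).comp_left
      (g := fun A : RN N →L[ℝ] ℝ => A v) rfl
  zero_notMem := by
    rw [notMem_tsupport_iff_eventuallyEq]
    filter_upwards [hφ.eventually_eq_zero.fderiv (𝕜 := ℝ)] with x hx
    simp [hx]

lemma mul_left (hφ : IsTestOff φ) (hf : ∀ x, x ≠ 0 → ContDiffAt ℝ ∞ f x) :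
    IsTestOff (fun x => f x * φ x) where
  contDiff := contDiff_iff_contDiffAt.2 fun x => by
    rcases eq_or_ne x 0 with rfl | hx
    · refine (contDiffAt_const (c := (0 : ℝ))).congr_of_eventuallyEq ?_
      filter_upwards [hφ.eventually_eq_zero] with y hy
      simp [hy]
    · exact (hf x hx).mul hφ.contDiff.contDiffAt
  hasCompactSupport := hφ.hasCompactSupport.mul_left
  zero_notMem := by
    rw [notMem_tsupport_iff_eventuallyEq]
    filter_upwards [hφ.eventually_eq_zero] with x hx
    simp [hx]

lemma integrable_mul (hφ : IsTestOff φ) {k : RN N → ℝ} (hk : LocallyIntegrable k volume) :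
    Integrable (fun x => k x * φ x) volume := by
  have := hk.integrable_smul_left_of_hasCompactSupport hφ.contDiff.continuous hφ.hasCompactSupport
  simpa [mul_comm] using this

lemma fderiv_coord_mul (hφ : IsTestOff φ) (p a : Fin N) (x : RN N) :
    fderiv ℝ (fun y : RN N => y p * φ y) x (EuclideanSpace.single a 1) =
      (if p = a then φ x else 0) + x p * fderiv ℝ φ x (EuclideanSpace.single a 1) := by
  have h1 : HasFDerivAt (fun y : RN N => y p) (EuclideanSpace.proj p : RN N →L[ℝ] ℝ) x :=
    (EuclideanSpace.proj p : RN N →L[ℝ] ℝ).hasFDerivAt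
  have h2 := (hφ.contDiff.differentiable (by norm_num) x).hasFDerivAt
  rw [(h1.fun_mul h2).fderiv]
  by_cases h : p = a
  · simp [h]; ring
  · simp [h]

end IsTestOff

lemma contDiffAt_coord (p : Fin N) (x : RN N) : ContDiffAt ℝ ∞ (fun y : RN N => y p) x :=
  (EuclideanSpace.proj p : RN N →L[ℝ] ℝ).contDiff.contDiffAt

/-- In the sense of distributions off the origin, `k ∇ ^ (m + 1) log` has symmetric derivative. -/
def IsClosedMul (N m : ℕ) (k : RN N → ℝ) : Prop :=
  ∀ (i j : Fin N) (I : Fin m → Fin N) (φ : RN N → ℝ), IsTestOff φ →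
    ∫ x, k x * (partialDeriv (Fin.cons i I : Fin (m + 1) → Fin N) (logNorm N) x *
        fderiv ℝ φ x (EuclideanSpace.single j 1) -
      partialDeriv (Fin.cons j I : Fin (m + 1) → Fin N) (logNorm N) x *
        fderiv ℝ φ x (EuclideanSpace.single i 1)) = 0

lemma integrable_closed_integrand {k : RN N → ℝ} (hk : LocallyIntegrable k volume) {φ : RN N → ℝ}
    (hφ : IsTestOff φ) (i j : Fin m → Fin N) (a b : Fin N) :
    Integrable (fun x => k x * (partialDeriv i (logNorm N) x *
        fderiv ℝ φ x (EuclideanSpace.single a 1) -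
      partialDeriv j (logNorm N) x * fderiv ℝ φ x (EuclideanSpace.single b 1))) volume := by
  have h : ∀ (i : Fin m → Fin N) (a : Fin N), Integrable (fun x => k x *
      (partialDeriv i (logNorm N) x * fderiv ℝ φ x (EuclideanSpace.single a 1))) volume :=
    fun i a => ((hφ.fderiv_apply _).mul_left
      fun x hx => (contDiffAt_logNorm hx).partialDeriv i).integrable_mul hk
  refine ((h i a).sub (h j b)).congr (.of_forall fun x => ?_)
  simp only [Pi.sub_apply]; ring

/-- Test with x_p φ, append the index p, and sum over p. Terms where the derivative hits x_p are
symmetric in i, j and cancel; Euler's identity turns the others into the condition one order lower,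
times -(m + 1). -/
lemma IsClosedMul.of_succ {k : RN N → ℝ} (hk : LocallyIntegrable k volume)
    (h : IsClosedMul N (m + 1) k) : IsClosedMul N m k := by
  intro i j I φ hφ
  have hp : ∀ p : Fin N, IsTestOff (fun y : RN N => y p * φ y) := fun p =>
    hφ.mul_left fun x _ => contDiffAt_coord p x
  have h1 := Finset.sum_eq_zero (s := Finset.univ)
    fun p _ => h i j (Fin.cons p I) _ (hp p)
  rw [← integral_finsetSum _ fun p _ => integrable_closed_integrand hk (hp p) _ _ _ _] at h1
  have hm : (-((m + 1 : ℕ) : ℝ)) ≠ 0 := neg_ne_zero.2 (by positivity)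
  refine (mul_eq_zero.1 ?_).resolve_left hm
  rw [← h1, ← integral_const_mul]
  refine integral_congr_ae (.of_forall fun x => ?_)
  simp only
  rcases eq_or_ne x 0 with rfl | hx
  · have h0 : ∀ p a, fderiv ℝ (fun y : RN N => y p * φ y) 0 (EuclideanSpace.single a 1) = 0 :=
      fun p a => ((hp p).fderiv_apply _).eventually_eq_zero.eq_of_nhds
    have h0' : ∀ a, fderiv ℝ φ 0 (EuclideanSpace.single a 1) = 0 :=
      fun a => (hφ.fderiv_apply _).eventually_eq_zero.eq_of_nhds
    simp [h0, h0']
  · have key : ∀ a b : Fin N, ∑ p, partialDeriv (Fin.cons a (Fin.cons p I : Fin (m + 1) → Fin N) :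
        Fin (m + 2) → Fin N) (logNorm N) x *
          fderiv ℝ (fun y : RN N => y p * φ y) x (EuclideanSpace.single b 1) =
        partialDeriv (Fin.cons a (Fin.cons b I : Fin (m + 1) → Fin N) :
          Fin (m + 2) → Fin N) (logNorm N) x * φ x +
        (-((m + 1 : ℕ) : ℝ) * partialDeriv (Fin.cons a I : Fin (m + 1) → Fin N) (logNorm N) x) *
          fderiv ℝ φ x (EuclideanSpace.single b 1) := by
      intro a b
      rw [← sum_coord_mul_partialDeriv_logNorm (by omega) hx, Finset.sum_mul]
      simp_rw [hφ.fderiv_coord_mul, mul_add, Finset.sum_add_distrib]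
      congr 1
      · simp
      · refine Finset.sum_congr rfl fun p _ => ?_
        rw [partialDeriv_swap (contDiffAt_logNorm hx)]
        ring
    rw [← Finset.mul_sum, Finset.sum_sub_distrib, key, key,
      partialDeriv_swap (contDiffAt_logNorm hx) j i]
    ring

lemma IsClosedMul.one {k : RN N → ℝ} (hk : LocallyIntegrable k volume) (hm : 1 ≤ m)
    (h : IsClosedMul N m k) : IsClosedMul N 1 k := by
  induction m, hm using Nat.le_induction with
  | base => exact h
  | succ m _ ih => exact ih (h.of_succ hk)

lemma partialDeriv_one_logNorm {x : RN N} (hx : x ≠ 0) (i : Fin 1 → Fin N) :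
    partialDeriv i (logNorm N) x = x (i 0) / ‖x‖ ^ 2 := by
  rw [partialDeriv, iteratedFDeriv_one_apply, fderiv_logNorm hx]
  simp [EuclideanSpace.inner_single_right]

lemma sum_partialDeriv_two_logNorm {x : RN N} (hx : x ≠ 0) :
    ∑ i, partialDeriv (Fin.cons i (fun _ : Fin 1 => i) : Fin 2 → Fin N) (logNorm N) x =
      (N - 2) / ‖x‖ ^ 2 := by
  have hx' : ‖x‖ ≠ 0 := norm_ne_zero_iff.2 hx
  have h : ∀ i, partialDeriv (Fin.cons i (fun _ : Fin 1 => i) : Fin 2 → Fin N) (logNorm N) x =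
      1 / ‖x‖ ^ 2 - 2 / ‖x‖ ^ 4 * (x i) ^ 2 := by
    intro i
    rw [partialDeriv_cons (contDiffAt_logNorm hx)]
    have hev : partialDeriv (fun _ : Fin 1 => i) (logNorm N) =ᶠ[nhds x]
        fun y => y i / ‖y‖ ^ 2 := by
      filter_upwards [isOpen_ne.mem_nhds hx] with y hy using partialDeriv_one_logNorm hy _
    have h1 : HasFDerivAt (fun y : RN N => y i) (EuclideanSpace.proj i : RN N →L[ℝ] ℝ) x :=
      (EuclideanSpace.proj i : RN N →L[ℝ] ℝ).hasFDerivAt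
    have h2 : HasFDerivAt (fun y : RN N => ‖y‖ ^ 2) (2 • innerSL ℝ x) x :=
      (hasStrictFDerivAt_norm_sq x).hasFDerivAt
    have h3 := (hasDerivAt_inv (pow_ne_zero 2 hx')).comp_hasFDerivAt x h2
    simp_rw [div_eq_mul_inv] at hev
    simp only [Function.comp_def] at h3
    rw [hev.fderiv_eq, (h1.fun_mul h3).fderiv]
    simp [EuclideanSpace.inner_single_right]
    field_simp
    ring
  simp_rw [h, Finset.sum_sub_distrib, ← Finset.mul_sum, ← EuclideanSpace.real_norm_sq_eq]
  simp
  field_simp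

/-- Use the index triple (i, j, i) with test function x_j ψ and sum over i, j: traces give Δ log|x|
= (N-2)/|x|², and the mixed terms contract by Euler's identity. -/
lemma IsClosedMul.integral_eq_zero {k : RN N → ℝ} (hk : LocallyIntegrable k volume)
    (h : IsClosedMul N 1 k) {ψ : RN N → ℝ} (hψ : IsTestOff ψ) :
    ∫ x, k x * ((N - 1) / ‖x‖ ^ 2 * ((N - 2) * ψ x + fderiv ℝ ψ x x)) = 0 := by
  have hp : ∀ p : Fin N, IsTestOff (fun y : RN N => y p * ψ y) := fun p =>
    hψ.mul_left fun x _ => contDiffAt_coord p x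
  have h1 := Finset.sum_eq_zero (s := Finset.univ) fun q (_ : q ∈ Finset.univ) =>
    h (q : Fin N × Fin N).1 q.2 (fun _ => q.1) _ (hp q.2)
  rw [← integral_finsetSum _ fun q _ => integrable_closed_integrand hk (hp q.2) _ _ _ _] at h1
  rw [← h1]
  refine integral_congr_ae (.of_forall fun x => ?_)
  simp only
  rcases eq_or_ne x 0 with rfl | hx
  · have h0 : ∀ p a, fderiv ℝ (fun y : RN N => y p * ψ y) 0 (EuclideanSpace.single a 1) = 0 :=
      fun p a => ((hp p).fderiv_apply _).eventually_eq_zero.eq_of_nhds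
    simp [h0]
  · have hx' : ‖x‖ ≠ 0 := norm_ne_zero_iff.2 hx
    rw [← Finset.mul_sum]
    congr 1
    simp_rw [hψ.fderiv_coord_mul]
    set G := fderiv ℝ ψ x
    have hG : ∑ p, x p * G (EuclideanSpace.single p 1) = G x := sum_coord_mul_clm G x
    have htr := sum_partialDeriv_two_logNorm hx
    have he : ∀ i : Fin N, ∑ j, x j *
        partialDeriv (Fin.cons j (fun _ : Fin 1 => i) : Fin 2 → Fin N) (logNorm N) x =
        -(x i / ‖x‖ ^ 2) := fun i => by
      rw [sum_coord_mul_partialDeriv_logNorm one_ne_zero hx, partialDeriv_one_logNorm hx]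
      simp
    rw [Fintype.sum_prod_type]
    simp only [if_true, Finset.sum_sub_distrib, mul_add, Finset.sum_add_distrib,
      ← Finset.mul_sum, ← Finset.sum_mul, hG, htr]
    have h3 : ∑ i, ∑ j, partialDeriv (Fin.cons j (fun _ : Fin 1 => i) : Fin 2 → Fin N)
        (logNorm N) x * (if j = i then ψ x else 0) = (N - 2) / ‖x‖ ^ 2 * ψ x := by
      simp [← htr, Finset.sum_mul]
    have h4 : ∑ i, ∑ j, partialDeriv (Fin.cons j (fun _ : Fin 1 => i) : Fin 2 → Fin N)
        (logNorm N) x * (x j * G (EuclideanSpace.single i 1)) = -(G x / ‖x‖ ^ 2) := by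
      rw [← hG, Finset.sum_div, ← Finset.sum_neg_distrib]
      refine Finset.sum_congr rfl fun i _ => ?_
      rw [show -(x i * G (EuclideanSpace.single i 1) / ‖x‖ ^ 2) =
        -(x i / ‖x‖ ^ 2) * G (EuclideanSpace.single i 1) by ring, ← he, Finset.sum_mul]
      exact Finset.sum_congr rfl fun j _ => by ring
    rw [h3, h4]
    simp
    field_simp
    ring

/-- An integrable function whose product with `x` is divergence free off the origin vanishes. -/
lemma ae_eq_zero_of_integral_mul_fderiv_self (hN : 1 ≤ N) {h : RN N → ℝ}
    (hh : Integrable h volume)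
    (hF : ∀ F : RN N → ℝ, IsTestOff F → ∫ x, h x * fderiv ℝ F x x = 0) : h =ᵐ[volume] 0 := by
  have hzero : ∀ F : RN N → ℝ, IsTestOff F → ∫ x, h x * F x = 0 := by
    intro F hFt
    -- The pairing of h with dilates of F is constant in t by hypothesis, yet tends to 0 because e^t
    -- x leaves the support of F for every x ≠ 0.
    let g : ℝ → ℝ := fun t => ∫ x, h x * F (Real.exp t • x)
    have hdF : Continuous (fderiv ℝ F) := hFt.contDiff.continuous_fderiv (by norm_num)
    have hcs : HasCompactSupport (fun y => fderiv ℝ F y y) :=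
      HasCompactSupport.mono (f := fderiv ℝ F) (hFt.hasCompactSupport.fderiv (𝕜 := ℝ))
        fun y hy => by
          contrapose! hy
          simp only [Function.mem_support, not_not] at hy ⊢
          simp [hy]
    have hcd : Continuous (fun y => fderiv ℝ F y y) := hdF.clm_apply continuous_id
    obtain ⟨C, hC⟩ := hcd.bounded_above_of_compact_support hcs
    obtain ⟨B, hB⟩ := hFt.contDiff.continuous.bounded_above_of_compact_support
      hFt.hasCompactSupport
    have hderiv : ∀ t, HasDerivAt g
        (∫ x, h x * fderiv ℝ F (Real.exp t • x) (Real.exp t • x)) t := by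
      intro t
      refine (hasDerivAt_integral_of_dominated_loc_of_deriv_le (μ := (volume : Measure (RN N)))
        (F := fun t x => h x * F (Real.exp t • x))
        (F' := fun t x => h x * fderiv ℝ F (Real.exp t • x) (Real.exp t • x))
        (bound := fun x => ‖h x‖ * C) (s := Set.univ)
        Filter.univ_mem (.of_forall fun t => ?_) ?_ ?_ ?_ (hh.norm.mul_const C) ?_).2
      · exact hh.aestronglyMeasurable.mul (hFt.contDiff.continuous.comp
          (continuous_const_smul _)).aestronglyMeasurable
      · exact hh.mul_bdd (hFt.contDiff.continuous.comp
          (continuous_const_smul _)).aestronglyMeasurable (.of_forall fun x => hB _)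
      · exact hh.aestronglyMeasurable.mul (hcd.comp (continuous_const_smul _)).aestronglyMeasurable
      · refine .of_forall fun x t _ => ?_
        rw [norm_mul]
        exact mul_le_mul_of_nonneg_left (hC _) (norm_nonneg _)
      · refine .of_forall fun x t _ => HasDerivAt.const_mul _ ?_
        exact ((hFt.contDiff.differentiable (by norm_num) _).hasFDerivAt).comp_hasDerivAt t
          ((Real.hasDerivAt_exp t).smul_const x)
    have hscale : ∀ t, ∫ x, h x * fderiv ℝ F (Real.exp t • x) (Real.exp t • x) = 0 := by
      intro t
      have hpos := Real.exp_pos t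
      have hFs : IsTestOff (fun x => F (Real.exp t • x)) :=
        { contDiff := hFt.contDiff.comp (contDiff_const_smul _)
          hasCompactSupport := hFt.hasCompactSupport.comp_smul hpos.ne'
          zero_notMem := by
            rw [notMem_tsupport_iff_eventuallyEq]
            have : Filter.Tendsto (fun x : RN N => Real.exp t • x) (nhds 0) (nhds 0) := by
              simpa using (continuous_const_smul (Real.exp t)).tendsto (0 : RN N)
            exact this.eventually hFt.eventually_eq_zero }
      rw [← hF _ hFs]
      refine integral_congr_ae (.of_forall fun x => ?_)
      simp only
      rw [fderiv_comp_smul]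
      simp
    have hconst : ∀ t, g t = g 0 := fun t =>
      is_const_of_deriv_eq_zero (fun t => (hderiv t).differentiableAt)
        (fun t => by rw [(hderiv t).deriv, hscale t]) t 0
    have hlim : Filter.Tendsto g Filter.atTop (nhds (∫ _ : RN N, (0 : ℝ))) := by
      refine tendsto_integral_filter_of_dominated_convergence (fun x => ‖h x‖ * B)
        (.of_forall fun t => ?_) (.of_forall fun t => .of_forall fun x => ?_)
        (hh.norm.mul_const B) ?_
      · exact hh.aestronglyMeasurable.mul (hFt.contDiff.continuous.comp
          (continuous_const_smul _)).aestronglyMeasurable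
      · rw [norm_mul]
        exact mul_le_mul_of_nonneg_left (hB _) (norm_nonneg _)
      · filter_upwards [ae_ne_point hN (0 : RN N)] with x hx
        refine tendsto_const_nhds.congr' ?_
        obtain ⟨R, hR⟩ := hFt.hasCompactSupport.isCompact.isBounded.subset_closedBall 0
        have hx' : 0 < ‖x‖ := norm_pos_iff.2 hx
        filter_upwards [Real.tendsto_exp_atTop.eventually_gt_atTop (R / ‖x‖)] with t ht
        rw [div_lt_iff₀ hx'] at ht
        have : Real.exp t • x ∉ tsupport F := fun hmem => by
          have := mem_closedBall_zero_iff.1 (hR hmem)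
          rw [norm_smul, Real.norm_of_nonneg (Real.exp_pos t).le] at this
          linarith
        rw [image_eq_zero_of_notMem_tsupport this, mul_zero]
    have hg0 : g 0 = 0 := by
      have := hlim.congr hconst
      simpa using tendsto_nhds_unique tendsto_const_nhds this
    simpa [g] using hg0
  have h1 := isOpen_compl_singleton (x := (0 : RN N)).ae_eq_zero_of_integral_contDiff_smul_eq_zero
    (μ := volume) (f := h) (hh.locallyIntegrable.locallyIntegrableOn _)
    fun F hF1 hF2 hF3 => by
      simpa [mul_comm] using hzero F ⟨hF1, hF2, fun h0 => hF3 h0 rfl⟩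
  filter_upwards [h1, ae_ne_point hN (0 : RN N)] with x hx hx0 using hx hx0

lemma contDiffAt_inv_norm_pow {x : RN N} (hx : x ≠ 0) (n : ℕ) :
    ContDiffAt ℝ ∞ (fun y : RN N => (‖y‖ ^ n)⁻¹) x :=
  (contDiffAt_norm_pow hx n).inv (pow_ne_zero _ (norm_ne_zero_iff.2 hx))

lemma fderiv_inv_norm_pow_mul {n : ℕ} {F : RN N → ℝ} (hF : IsTestOff F) {x : RN N} (hx : x ≠ 0) :
    fderiv ℝ (fun y => (‖y‖ ^ n)⁻¹ * F y) x x =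
      (‖x‖ ^ n)⁻¹ * (fderiv ℝ F x x - n * F x) := by
  have h1 : DifferentiableAt ℝ (fun y : RN N => (‖y‖ ^ n)⁻¹) x :=
    (contDiffAt_inv_norm_pow hx n).differentiableAt (by norm_num)
  have h2 := fderiv_self_of_homogeneous (m := n) h1 fun a ha => by
    rw [norm_smul, Real.norm_of_nonneg ha.le, mul_pow, mul_inv]
  rw [(h1.hasFDerivAt.fun_mul (hF.contDiff.differentiable (by norm_num) x).hasFDerivAt).fderiv]
  simp only [_root_.add_apply, _root_.smul_apply, smul_eq_mul, h2]
  ring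

/-- If the derivatives of order `N ≥ 2` of a function are an integrable multiple of the
(translated) kernel, then they vanish. -/
lemma ae_eq_zero_of_weakPartial_eq_mul_kernel (hN : 2 ≤ N) {u h : RN N → ℝ} (hu : MemW N u)
    (hh : Integrable h volume) (x₀ : RN N)
    (heq : ∀ᵐ x, ∀ i : Fin N → Fin N, weakPartial i u (x + x₀) = h x * kernel N x i) :
    h =ᵐ[volume] 0 := by
  obtain ⟨n, rfl⟩ : ∃ n, N = n + 2 := ⟨N - 2, by omega⟩
  have hk : LocallyIntegrable (fun x : RN (n + 2) => h x * ‖x‖ ^ (n + 2)) volume := by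
    have := hh.locallyIntegrable.smul_continuous (g := fun x : RN (n + 2) => ‖x‖ ^ (n + 2))
      (by fun_prop)
    exact this
  -- Both sides of the commutation relation for weak derivatives of u are rewritten through the
  -- kernel, after translating x₀ to the origin.
  have hcl : IsClosedMul (n + 2) (n + 1) (fun x => h x * ‖x‖ ^ (n + 2)) := by
    intro i j I φ hφ
    have h1 := (hu.hasWeakPartial (Fin.cons i I)).1.integral_mul_fderiv_comm
      (hu.hasWeakPartial (Fin.cons j I)).1 (φ := fun y => φ (y - x₀))
      (hφ.contDiff.comp (contDiff_id.sub contDiff_const))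
      (hφ.hasCompactSupport.comp_homeomorph (Homeomorph.subRight x₀))
    simp_rw [fderiv_comp_sub] at h1
    rw [← integral_add_right_eq_self _ x₀] at h1
    nth_rw 2 [← integral_add_right_eq_self _ x₀] at h1
    simp only [add_sub_cancel_right] at h1
    have hint : ∀ (J : Fin (n + 2) → Fin (n + 2)) (a : Fin (n + 2)), Integrable (fun x =>
        h x * ‖x‖ ^ (n + 2) * (partialDeriv J (logNorm (n + 2)) x *
          fderiv ℝ φ x (EuclideanSpace.single a 1))) volume := fun J a =>
      ((hφ.fderiv_apply _).mul_left
        fun x hx => (contDiffAt_logNorm hx).partialDeriv J).integrable_mul hk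
    have h2 : ∀ (J : Fin (n + 2) → Fin (n + 2)) (a : Fin (n + 2)),
        ∫ x, weakPartial J u (x + x₀) * fderiv ℝ φ x (EuclideanSpace.single a 1) =
        ∫ x, h x * ‖x‖ ^ (n + 2) * (partialDeriv J (logNorm (n + 2)) x *
          fderiv ℝ φ x (EuclideanSpace.single a 1)) := fun J a => by
      refine integral_congr_ae ?_
      filter_upwards [heq] with x hx
      rw [hx J, kernel_apply]
      ring
    rw [h2, h2] at h1
    simp_rw [mul_sub]
    rw [integral_sub (hint _ _) (hint _ _), h1, sub_self]
  refine ae_eq_zero_of_integral_mul_fderiv_self (by omega) hh fun F hF => ?_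
  -- With n = N - 2 this weight cancels the zero-order term, and the powers |x|^(n+2), |x|^(-2),
  -- |x|^(-n) multiply to 1, leaving (N-1) h x·∇F.
  have hψ : IsTestOff (fun y : RN (n + 2) => (‖y‖ ^ n)⁻¹ * F y) :=
    hF.mul_left fun x hx => contDiffAt_inv_norm_pow hx n
  have h3 := (hcl.one hk (by omega)).integral_eq_zero hk hψ
  -- This is the factor N - 1, which would vanish in dimension one.
  have hn : ((n : ℝ) + 1) ≠ 0 := by positivity
  refine (mul_eq_zero.1 ?_).resolve_left hn
  rw [← integral_const_mul, ← h3]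
  refine integral_congr_ae ?_
  filter_upwards [ae_ne_point (by omega) (0 : RN (n + 2))] with x hx
  have hx' : ‖x‖ ≠ 0 := norm_ne_zero_iff.2 hx
  rw [fderiv_inv_norm_pow_mul hF hx]
  push_cast
  field_simp
  ring

end

/-! ### The inequality and its equality case. -/

section

variable {N : ℕ}

lemma MemW.eLpNorm_top_le {u : RN N → ℝ} {a c B : ℝ} (hc : c ≠ 0)
    {P : RN N → ℝ} (hP : P =ᵐ[volume] fun x => c * u x) (hPB : ∀ x, |P x| ≤ B)
    (ha : |c|⁻¹ * B ≤ a) : eLpNorm u ∞ volume ≤ ENNReal.ofReal a := by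
  rw [eLpNorm_exponent_top]
  refine (eLpNormEssSup_le_of_ae_bound (C := |c|⁻¹ * B) ?_).trans (ENNReal.ofReal_le_ofReal ha)
  filter_upwards [hP] with x hx
  rw [Real.norm_eq_abs, ← div_eq_inv_mul, le_div_iff₀ (abs_pos.2 hc), mul_comm, ← abs_mul, ← hx]
  exact hPB x

lemma SobolevAdmissible.smoothAdmissible {C : ℝ} (h : SobolevAdmissible N C) :
    SmoothAdmissible N C := fun u hu hs => by
  rw [← integral_congr_ae (weakGradNorm_ae_eq_gradNorm (m := N) hu hs)]
  exact h u (.of_contDiff hu hs)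

/-- When the potential attains its largest conceivable value, the density is a multiple of the
translated kernel. -/
lemma ae_eq_smul_kernel_of_abs_potential_eq (hN : 1 ≤ N) {s : ℝ} (hs0 : 0 < s)
    (hs : ∀ x : RN N, x ≠ 0 → ‖kernel N x‖ = s) (hle : ∀ x, ‖kernel N x‖ ≤ s)
    {G : RN N → EuclideanSpace ℝ (Fin N → Fin N)} (hG : Integrable G volume) {x₀ : RN N}
    (hx₀ : |potential G x₀| = s * ∫ y, ‖G y‖) :
    ∃ σ : ℝ, |σ| = 1 ∧ ∀ᵐ y, G y = (σ * ‖G y‖ / s) • kernel N (y - x₀) := by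
  obtain ⟨σ, hσ, hσP⟩ : ∃ σ : ℝ, |σ| = 1 ∧ σ * potential G x₀ = s * ∫ y, ‖G y‖ := by
    rcases abs_choice (potential G x₀) with h | h
    · exact ⟨1, by simp, by rw [← hx₀, h, one_mul]⟩
    · exact ⟨-1, by simp, by rw [← hx₀, h]; ring⟩
  refine ⟨σ, hσ, ?_⟩
  have hi := integrable_inner_kernel hle hG x₀
  -- The Cauchy–Schwarz deficit is nonnegative; its integral will be zero, so it vanishes almost
  -- everywhere.
  have hnn : ∀ y, 0 ≤ s * ‖G y‖ - σ * inner ℝ (G y) (kernel N (y - x₀)) := fun y => by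
    have h1 := abs_inner_kernel_le (G := G) hle x₀ y
    have h2 : σ * inner ℝ (G y) (kernel N (y - x₀)) ≤ ‖G y‖ * s :=
      (le_abs_self _).trans (by rw [abs_mul, hσ, one_mul]; exact h1)
    linarith
  have hzero : ∫ y, (s * ‖G y‖ - σ * inner ℝ (G y) (kernel N (y - x₀))) = 0 := by
    rw [integral_sub (hG.norm.const_mul s) (hi.const_mul σ), integral_const_mul,
      integral_const_mul, ← hσP]
    exact sub_self _
  have hae := (integral_eq_zero_iff_of_nonneg hnn
    ((hG.norm.const_mul s).sub (hi.const_mul σ))).1 hzero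
  filter_upwards [hae, ae_ne_point hN x₀] with y hy hne
  have hk : ‖σ • kernel N (y - x₀)‖ = s := by
    rw [norm_smul, hs _ (sub_ne_zero.2 hne), Real.norm_eq_abs, hσ, one_mul]
  have h1 : inner ℝ (G y) (σ • kernel N (y - x₀)) = ‖G y‖ * ‖σ • kernel N (y - x₀)‖ := by
    rw [hk, real_inner_smul_right]
    simp only [Pi.zero_apply] at hy
    linarith
  have h2 := inner_eq_norm_mul_iff_real.1 h1
  rw [hk] at h2
  calc G y = s⁻¹ • s • G y := (inv_smul_smul₀ hs0.ne' _).symm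
    _ = _ := by rw [h2, smul_smul, smul_smul]; congr 1; ring

end

theorem theorem1 (N : ℕ) (hN : 1 ≤ N) :
    ∃ ℓ : ℝ, 0 < ℓ ∧
      (∀ x : RN N, x ≠ 0 →
        gradNorm N (fun y : RN N => Real.log ‖y‖) x = Real.sqrt ℓ / ‖x‖ ^ N) ∧
      IsLeast {C : ℝ | SmoothAdmissible N C} (Real.sqrt ℓ * sphereArea N)⁻¹ ∧
      IsLeast {C : ℝ | SobolevAdmissible N C} (Real.sqrt ℓ * sphereArea N)⁻¹ ∧
      (2 ≤ N → ∀ u : RN N → ℝ, MemW N u → ¬ (u =ᵐ[volume] 0) →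
        eLpNorm u ∞ volume ≠
          ENNReal.ofReal ((Real.sqrt ℓ * sphereArea N)⁻¹ * ∫ x, weakGradNorm N u x)) := by
  obtain ⟨s, hs⟩ := exists_norm_gradTensor_logNorm hN
  have hs0 : 0 < s := by
    have := nontrivial_RN hN
    obtain ⟨x, hx⟩ := exists_ne (0 : RN N)
    have h1 : 0 < ‖gradTensor N (logNorm N) x‖ := norm_pos_iff.2 (gradTensor_logNorm_ne_zero hN hx)
    rw [hs x hx] at h1
    exact (div_pos_iff_of_pos_right (pow_pos (norm_pos_iff.2 hx) N)).1 h1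
  have hω := sphereArea_pos hN
  have hle := norm_kernel_le hN hs0.le hs
  obtain ⟨c, hc⟩ := exists_integral_inner_kernel hN
  have hcs := kernel_constant_eq hN hs hs0.le hc
  have hc0 : c ≠ 0 := by rw [hcs]; exact neg_ne_zero.2 (by positivity)
  have hcabs : |c| = s ^ 2 * sphereArea N := by
    rw [hcs, abs_neg, abs_of_pos (by positivity)]
  have hSob : SobolevAdmissible N (s * sphereArea N)⁻¹ := fun u hu => by
    have hG := hu.integrable_weakGradTensor
    refine MemW.eLpNorm_top_le hc0 (potential_ae_eq hN hle hc hu) (abs_potential_le hle hG) ?_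
    simp_rw [weakGradNorm_eq_norm]
    rw [hcabs]
    apply le_of_eq
    field_simp
  have hlow : ∀ C, SmoothAdmissible N C → (s * sphereArea N)⁻¹ ≤ C := fun C hC =>
    hC.le hN hs hs0
  refine ⟨s ^ 2, by positivity, ?_⟩
  rw [Real.sqrt_sq hs0.le]
  refine ⟨fun x hx => ?_, ⟨hSob.smoothAdmissible, hlow⟩,
    ⟨hSob, fun C hC => hlow C hC.smoothAdmissible⟩, fun hN2 u hu hu0 heq => hu0 ?_⟩
  · exact (gradNorm_eq_norm _ _).trans (hs x hx)
  have hG := hu.integrable_weakGradTensor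
  have hP := potential_ae_eq hN hle hc hu
  obtain ⟨x₀, hmax⟩ := exists_abs_potential_max hN hle hG
    (integral_weakGradTensor (by omega) hu)
  have hx₀ : |potential (weakGradTensor N u) x₀| = s * ∫ y, ‖weakGradTensor N u y‖ := by
    refine le_antisymm (abs_potential_le hle hG x₀) ?_
    -- The supremum of u is at most |c|⁻¹ times the maximum of the potential, so equality forces
    -- that maximum up to its a priori bound.
    have h1 := MemW.eLpNorm_top_le hc0 hP hmax le_rfl
    rw [heq, ENNReal.ofReal_le_ofReal_iff (by positivity), hcabs] at h1
    simp_rw [weakGradNorm_eq_norm] at h1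
    have h2 := mul_le_mul_of_nonneg_left h1 (by positivity : 0 ≤ s ^ 2 * sphereArea N)
    field_simp at h2
    linarith
  obtain ⟨σ, hσ, hker⟩ := ae_eq_smul_kernel_of_abs_potential_eq hN hs0
    (fun x hx => norm_kernel hs hx) hle hG hx₀
  have hh : Integrable (fun x => σ * ‖weakGradTensor N u (x + x₀)‖ / s) volume :=
    ((hG.comp_add_right x₀).norm.const_mul σ).div_const s
  have hker' := (measurePreserving_add_right volume x₀).quasiMeasurePreserving.ae hker
  have hzero := ae_eq_zero_of_weakPartial_eq_mul_kernel hN2 hu hh x₀ (by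
    filter_upwards [hker'] with x hx i
    have := congrArg (fun v : EuclideanSpace ℝ (Fin N → Fin N) => v i) hx
    simp only [add_sub_cancel_right] at this
    exact this)
  -- Since |h| = ‖∇^N u(· + x₀)‖ / s, the vanishing of h kills the whole gradient, and then the
  -- maximum of the potential is 0.
  have hG0 : ∫ y, ‖weakGradTensor N u y‖ = 0 := by
    rw [← integral_add_right_eq_self _ x₀]
    refine integral_eq_zero_of_ae ?_
    filter_upwards [hzero] with x hx
    have hσ0 : σ ≠ 0 := by rintro rfl; simp at hσ
    simpa [hσ0, hs0.ne'] using hx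
  filter_upwards [hP] with x hx
  have h1 := hmax x
  rw [hx₀, hG0, mul_zero, hx] at h1
  simpa [hc0] using abs_nonpos_iff.1 h1
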